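/- A \emph{nondeterministic parity automaton} $\mathcal{A}=(Q,\Sigma,q_0,\Delta,\Omega)$ has a finite set $Q$ of states, a finite alphabet $\Sigma$, an initial state $q_0\in Q$, a set of transitions $\Delta\subseteq Q\times\Sigma\times Q$ and a priority function $\Omega:\Delta\to\mathbb{N}$. A run on $w\in\Sigma^\omega$ is an infinite path that starts at $q_0$ and follows transitions on the successive letters of $w$; it is accepting if the highest priority that occurs infinitely often on it is even. The language $L(\mathcal{A})\subseteq\Sigma^\omega$ is the set of words that have an accepting run. The automaton is \emph{history-deterministic} if Eve has a winning strategy in the letter game: in each of infinitely many rounds Adam chooses a letter and then Eve, knowing only the play so far, chooses a transition on this letter from her current state (starting at $q_0$); Eve wins a play if, whenever Adam's word is in $L(\mathcal{A})$, she has built an accepting run on it. Statement: for every fixed $d\in\mathbb{N}$, given a nondeterministic parity automaton $\mathcal{A}$ and a history-deterministic parity automaton $\mathcal{B}$ over a common finite alphabet, both with priorities in $[d]=\{0,1,\dots,d\}$, the problem of whether $L(\mathcal{A})\subseteq L(\mathcal{B})$ can be decided in polynomial time. Precisely, for every $d$ there is a Turing machine that, on every pair $(\mathcal{A},\mathcal{B})$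 of nondeterministic parity automata over a common finite alphabet with priorities in $[d]$, halts with a yes/no answer after a number of steps that is polynomial in the size of the input (each automaton being given by its number of states, the number of letters, its initial state and the list of its transitions with their priorities, all numbers in unary), and whose answer is correct, i.e. it is "yes" if and only if $L(\mathcal{A})\subseteq L(\mathcal{B})$, whenever $\mathcal{B}$ is history-deterministic. -/

import Mathlib

open Filter

/-- A nondeterministic (transition-based) parity automaton with state set `Q` and alphabet `S`.
`trans p a q = some c` says that `(p, a, q)` is a transition and that its priority is `c`;
`trans p a q = none` says that `(p, a, q)` is not a transition. -/
structure ParityAutomaton (Q S : Type*) where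
  /-- the initial state -/
  init : Q
  /-- the transition relation together with the priority function -/
  trans : Q → S → Q → Option ℕ

/-- The parity condition for a sequence of priorities: there is a highest priority among those
that occur infinitely often, and it is even. -/
def ParityCondition (c : ℕ → ℕ) : Prop :=
  ∃ k : ℕ, Even k ∧ (∃ᶠ i in atTop, c i = k) ∧ ∀ l : ℕ, (∃ᶠ i in atTop, c i = l) → l ≤ k

namespace ParityAutomaton

variable {Q S : Type*}

/-- All priorities of the automaton lie in `[d] = {0, 1, ..., d}`. -/
def PrioritiesIn (A : ParityAutomaton Q S) (d : ℕ) : Prop :=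
  ∀ p a q c, A.trans p a q = some c → c ≤ d

/-- The state sequence `r` is a run on the infinite word `w`, and `c` is the sequence of the
priorities of the transitions that it takes. -/
def IsRun (A : ParityAutomaton Q S) (w : ℕ → S) (r : ℕ → Q) (c : ℕ → ℕ) : Prop :=
  r 0 = A.init ∧ ∀ i, A.trans (r i) (w i) (r (i + 1)) = some (c i)

/-- The state sequence `r` is an accepting run on the infinite word `w`. -/
def IsAcceptingRun (A : ParityAutomaton Q S) (w : ℕ → S) (r : ℕ → Q) : Prop :=
  ∃ c, A.IsRun w r c ∧ ParityCondition c

/-- The language of the automaton: the infinite words that have an accepting run. -/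
def language (A : ParityAutomaton Q S) : Set (ℕ → S) :=
  {w | ∃ r, A.IsAcceptingRun w r}

/-- A play of the letter game in which Adam spells the word `w` and Eve moves through the states
`r`, playing according to the strategy `σ`. In round `i` the strategy sees the letters
`w 0, ..., w i` that Adam has chosen and the states `r 0, ..., r i` that Eve has visited, and names
the target `r (i + 1)` of Eve's transition from `r i` on the letter `w i`. -/
def IsLetterPlay (A : ParityAutomaton Q S) (σ : List S → List Q → Q)
    (w : ℕ → S) (r : ℕ → Q) : Prop :=
  r 0 = A.init ∧
    ∀ i, r (i + 1) = σ ((List.range (i + 1)).map w) ((List.range (i + 1)).map r)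

/-- The automaton is history-deterministic: Eve has a strategy that wins every play of the letter
game that follows it, i.e. whenever Adam's word is in the language, Eve has built an accepting run
on it. In particular, if Eve ever has no transition to take (or names one that does not exist), then
she loses the play exactly if Adam's word is in the language. -/
def HistoryDeterministic (A : ParityAutomaton Q S) : Prop :=
  ∃ σ : List S → List Q → Q, ∀ w r, A.IsLetterPlay σ w r → w ∈ A.language → A.IsAcceptingRun w r

end ParityAutomaton

/-- An input of the containment problem with priorities in `[d]`: two finite nondeterministic parity
automata over a common finite alphabet, whose priorities are at most `d`. Letters and states are
numbered. -/
structure ContainmentInput (d : ℕ) where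
  /-- number of letters -/
  letters : ℕ
  /-- number of states of `A` -/
  statesA : ℕ
  /-- number of states of `B` -/
  statesB : ℕ
  /-- the first automaton -/
  A : ParityAutomaton (Fin statesA) (Fin letters)
  /-- the second automaton -/
  B : ParityAutomaton (Fin statesB) (Fin letters)
  /-- the priorities of `A` are in `[d]` -/
  boundA : A.PrioritiesIn d
  /-- the priorities of `B` are in `[d]` -/
  boundB : B.PrioritiesIn d

/-- The self-delimiting code `1 ... 1 0` of a number. -/
def numCode (k : ℕ) : List Bool := List.replicate k true ++ [false]

/-- The code of a finite list: every entry is announced by a `1`, and a `0` ends the list. -/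
def listCode {α : Type*} (code : α → List Bool) (l : List α) : List Bool :=
  l.flatMap (fun x => true :: code x) ++ [false]

/-- The code of a transition: source, letter, priority, target. -/
def transitionCode (t : ℕ × ℕ × ℕ × ℕ) : List Bool :=
  numCode t.1 ++ numCode t.2.1 ++ numCode t.2.2.1 ++ numCode t.2.2.2

/-- The list of all transitions `(source, letter, priority, target)` of a finite automaton. -/
def transitionList {n s : ℕ} (A : ParityAutomaton (Fin n) (Fin s)) : List (ℕ × ℕ × ℕ × ℕ) :=
  (List.finRange n).flatMap fun p =>
    (List.finRange s).flatMap fun a =>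
      (List.finRange n).filterMap fun q =>
        (A.trans p a q).map fun c => ((p : ℕ), (a : ℕ), c, (q : ℕ))

/-- The code of a finite automaton: number of states, initial state, list of transitions. -/
def automatonCode {n s : ℕ} (A : ParityAutomaton (Fin n) (Fin s)) : List Bool :=
  numCode n ++ numCode (A.init : ℕ) ++ listCode transitionCode (transitionList A)

/-- The bit string that is presented to the Turing machine: number of letters, then both
automata. -/
def ContainmentInput.code {d : ℕ} (I : ContainmentInput d) : List Bool :=
  numCode I.letters ++ automatonCode I.A ++ automatonCode I.B

/-!
Containment in a history-deterministic automaton `B` is equivalent to simulation by `B`: in the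
simulation game Adam builds a run of `A`, letter by letter and transition by transition, and Eve
answers with a run of `B` on the same word; she wins if her run is accepting or Adam's is not. If
Eve wins, then `L(A) ⊆ L(B)` without any assumption on `B` (`language_subset_of_mem_simRegion`).
Conversely, if `L(A) ⊆ L(B)` and Eve has a winning strategy in the letter game of `B`, then this
strategy wins the simulation game; here it is confronted with a winning strategy of Adam
(`mem_simRegion_of_language_subset`).

The winning condition is a disjunction of two parity conditions. A finite memory, the `Record`,
keeps for each priority `i` of `A` the highest priority of `B` since `A` last took a priority of at
least `i`. With it the condition becomes a single parity condition, whose priorities are the pairs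
of priorities in lexicographic order (`Record.isMaxRecurring_prio`). For fixed `d`, the memory and
the number of priorities are constant, and the size of the game is polynomial.

The parity game is solved by the nested fixed point of its one-step operator (`nest`, `simRegion`),
which, for a constant number of priorities, takes a polynomial number of evaluations. Progress
measures (`exists_progressMeasure`) give a strategy on the region. The complement of the region is a
nested fixed point of the dual operator (`nest_compl`), so they give a strategy of the opponent,
too. No determinacy theorem is needed.

To obtain a Turing machine, the algorithm is written in a small language of structured programs on
tapes (`TapeProg`), whose only loops have as many rounds as the input has letters. Each program is
compiled to a machine that runs in polynomial time (`TapeProg.exists_polyTime`). Iterating `L ^ e`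
times for a constant `e`, with `L` the length of the input, is `e` nested loops. As the numbers of
the input are in unary, letters and states are digits in base `L`, and the tables of the two
automata can be addressed by moving a head by `L ^ 2`, by `L` or by `1`. What a cell has to store
about the records is a finite set from a fixed range, and hence a letter of the tape alphabet.
-/

/-! ### Nested fixed points and progress measures -/

section NestedFixedPoints
variable {V : Type*}

/-- The nested fixed point `σ X (k - 1). … σ X 0. Φ X` of an operator `Φ` with the set variables
`X 0, X 1, …`, where `σ` binds the variable `X i` as a greatest fixed point if `i + b` is even and
as a least fixed point if it is odd; the variables from `X k` on are free. Each fixed point is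
replaced by `N` iterations from the top or from the bottom, which is enough if `N` is at least the
number of elements of `V` and `Φ` is monotone. -/
def nest (N b : ℕ) (Φ : (ℕ → Set V) → Set V) : ℕ → (ℕ → Set V) → Set V
  | 0, X => Φ X
  | k + 1, X =>
    (fun Y => nest N b Φ k (Function.update X k Y))^[N] (if Even (k + b) then Set.univ else ∅)

theorem nest_mono {N b : ℕ} {Φ : (ℕ → Set V) → Set V} (hΦ : Monotone Φ) (k : ℕ) :
    Monotone (nest N b Φ k) := by
  induction k with
  | zero => exact hΦ
  | succ k ih =>
    intro X X' h
    simp only [nest]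
    generalize (if Even (k + b) then Set.univ else ∅ : Set V) = Z
    have key : ∀ n, (fun Y => nest N b Φ k (Function.update X k Y))^[n] Z ≤
        (fun Y => nest N b Φ k (Function.update X' k Y))^[n] Z := by
      intro n
      induction n with
      | zero => exact le_rfl
      | succ n ihn =>
        rw [Function.iterate_succ_apply', Function.iterate_succ_apply']
        exact ih (update_le_update_iff.2 ⟨ihn, fun j _ => h j⟩)
    exact key N

/-- Complementation dualizes the operator and exchanges greatest and least fixed points. -/
theorem nest_compl (N b : ℕ) (Φ : (ℕ → Set V) → Set V) (k : ℕ) (X : ℕ → Set V) :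
    (nest N b Φ k X)ᶜ =
      nest N (b + 1) (fun Y => (Φ fun i => (Y i)ᶜ)ᶜ) k (fun i => (X i)ᶜ) := by
  induction k generalizing X with
  | zero => simp [nest]
  | succ k ih =>
    simp only [nest]
    have hZ : (if Even (k + (b + 1)) then Set.univ else ∅ : Set V) =
        (if Even (k + b) then Set.univ else ∅ : Set V)ᶜ := by
      by_cases h : Even (k + b) <;> simp [h, ← add_assoc, Nat.even_add_one]
    rw [hZ]
    generalize (if Even (k + b) then Set.univ else ∅ : Set V) = Z
    have key : ∀ m : ℕ, ((fun Y => nest N b Φ k (Function.update X k Y))^[m] Z)ᶜ =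
      (fun Y => nest N (b + 1) (fun Y => (Φ fun i => (Y i)ᶜ)ᶜ) k
        (Function.update (fun i => (X i)ᶜ) k Y))^[m] Zᶜ := by
      intro m
      induction m with
      | zero => rfl
      | succ m ihm =>
        rw [Function.iterate_succ_apply', Function.iterate_succ_apply', ← ihm, ih]
        congr 1
        funext i
        by_cases h : i = k <;> simp [h]
    exact key N

/-- The sets `F^[n] univ` decrease, and they lose an element in each step until they are
stationary. -/
theorem iterate_univ_stationary [Fintype V] {F : Set V → Set V} (hF : Monotone F) {N : ℕ}
    (hN : Fintype.card V ≤ N) : F (F^[N] Set.univ) = F^[N] Set.univ := by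
  have anti : ∀ n, F^[n + 1] Set.univ ⊆ F^[n] Set.univ := by
    intro n
    induction n with
    | zero => simp
    | succ n ih =>
      rw [Function.iterate_succ_apply' F (n + 1)]
      nth_rw 2 [Function.iterate_succ_apply']
      exact hF ih
  have key : ∀ n, F^[n + 1] Set.univ = F^[n] Set.univ ∨
      (F^[n + 1] Set.univ).ncard + (n + 1) ≤ Fintype.card V := by
    intro n
    induction n with
    | zero =>
      by_cases h : F^[0 + 1] Set.univ = F^[0] Set.univ
      · exact Or.inl h
      · right
        have := Set.ncard_lt_ncard ((anti 0).ssubset_of_ne h) (Set.toFinite _)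
        simp only [Function.iterate_zero, id, Set.ncard_univ, Nat.card_eq_fintype_card] at this
        omega
    | succ n ih =>
      by_cases h : F^[n + 1 + 1] Set.univ = F^[n + 1] Set.univ
      · exact Or.inl h
      · right
        rcases ih with ih | ih
        · refine absurd ?_ h
          rw [Function.iterate_succ_apply' F (n + 1), ih, ← Function.iterate_succ_apply' F, ih]
        · have := Set.ncard_lt_ncard ((anti (n + 1)).ssubset_of_ne h) (Set.toFinite _)
          omega
  rw [← Function.iterate_succ_apply' F]
  rcases key N with h | h
  · exact h
  · omega

/-- Progress measures: for each element `x` of the nested fixed point, membership in `Φ` can be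
justified by elements `y` of the fixed point whose ranks `ρ K` do not exceed those of `x`, for each
index `K` of a least fixed point that is at least the index of the variable through which `y`
enters, with a strict decrease if `K` is that index. The bound `B` on the ranks does not depend on
the free variables, so that a rank in a nested least fixed point can be combined lexicographically
with the stage of an outer one. -/
theorem exists_progressMeasure [Fintype V] {N b : ℕ} {Φ : (ℕ → Set V) → Set V} (hΦ : Monotone Φ)
    (hN : Fintype.card V ≤ N) (k : ℕ) :
    ∃ B, ∀ X, ∃ ρ : ℕ → V → ℕ, (∀ K x, ρ K x < B) ∧ ∀ x ∈ nest N b Φ k X,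
      x ∈ Φ fun i => if k ≤ i then X i else
        {y | y ∈ nest N b Φ k X ∧ ∀ K, i ≤ K → K < k → ¬ Even (K + b) →
          ρ K y + (if K = i then 1 else 0) ≤ ρ K x} := by
  classical
  induction k with
  | zero =>
    exact ⟨1, fun X => ⟨fun _ _ => 0, by simp, fun x hx => by simpa [nest] using hx⟩⟩
  | succ k ih =>
    obtain ⟨B, hB⟩ := ih
    choose ρ hρB hρ using hB
    by_cases hk : Even (k + b)
    -- A greatest fixed point: the ranks at its last approximation, which is stationary, will do.
    · refine ⟨B, fun X => ?_⟩
      set Z := nest N b Φ (k + 1) X with hZ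
      have hfix : nest N b Φ k (Function.update X k Z) = Z := by
        have hm : Monotone fun Y => nest N b Φ k (Function.update X k Y) := fun Y Y' h =>
          nest_mono hΦ k (update_le_update_iff.2 ⟨h, fun _ _ => le_rfl⟩)
        have := iterate_univ_stationary hm hN
        simpa [hZ, nest, hk] using this
      refine ⟨ρ (Function.update X k Z), hρB _, fun x hx => ?_⟩
      rw [← hfix] at hx
      refine hΦ (fun i => ?_) (hρ _ x hx)
      intro y hy
      rcases lt_trichotomy i k with hi | rfl | hi
      · simp only [hi.not_ge, if_false, Set.mem_ofPred_eq, hfix] at hy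
        have h1 : ¬ k + 1 ≤ i := by omega
        simp only [h1, if_false, Set.mem_ofPred_eq]
        refine ⟨hy.1, fun K h2 h3 h4 => hy.2 K h2 ?_ h4⟩
        rcases Nat.lt_succ_iff_lt_or_eq.1 h3 with h | rfl
        · exact h
        · exact absurd hk h4
      · simp only [le_refl, if_true, Function.update_self] at hy
        have h1 : ¬ i + 1 ≤ i := by omega
        simp only [h1, if_false, Set.mem_ofPred_eq]
        refine ⟨hy, fun K h2 h3 h4 => ?_⟩
        have : K = i := by omega
        exact absurd (this ▸ hk) h4
      · have h1 : k + 1 ≤ i := hi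
        simp only [hi.le, if_true, Function.update_of_ne hi.ne'] at hy
        simpa only [h1, if_true] using hy
    -- A least fixed point: `n x + 1` is the stage at which `x` enters. This is the rank at `k`, and
    -- below `k` it is combined lexicographically with the ranks relative to the stage before.
    · refine ⟨N * B + B + N + 1, fun X => ?_⟩
      set F := fun Y => nest N b Φ k (Function.update X k Y)
      set n : V → ℕ := fun x => if h : ∃ j, j < N ∧ x ∈ F^[j + 1] ∅ then Nat.find h else 0 with hn
      have hnN : ∀ x, n x ≤ N := by
        intro x
        simp only [hn]
        split_ifs with h
        · exact (Nat.find_spec h).1.le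
        · exact Nat.zero_le _
      have hmin : ∀ x j, j < N → x ∈ F^[j + 1] ∅ → n x ≤ j := by
        intro x j hj hx
        have h : ∃ j, j < N ∧ x ∈ F^[j + 1] ∅ := ⟨j, hj, hx⟩
        simp only [hn, h, dif_pos]
        exact Nat.find_min' h ⟨hj, hx⟩
      have hspec : ∀ x, x ∈ nest N b Φ (k + 1) X → n x < N ∧ x ∈ F^[n x + 1] ∅ := by
        intro x hx
        simp only [nest, hk, if_false] at hx
        have h : ∃ j, j < N ∧ x ∈ F^[j + 1] ∅ := by
          rcases N with _ | N
          · simp at hx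
          · exact ⟨N, N.lt_succ_self, hx⟩
        simp only [hn, h, dif_pos]
        exact Nat.find_spec h
      have hm : Monotone F := fun Y Y' h =>
          nest_mono hΦ k (update_le_update_iff.2 ⟨h, fun _ _ => le_rfl⟩)
      have hchain : Monotone fun j => F^[j] ∅ := by
        refine monotone_nat_of_le_succ fun j => ?_
        induction j with
        | zero => simp
        | succ j ih =>
          rw [Function.iterate_succ_apply', Function.iterate_succ_apply' F (j + 1)]
          exact hm ih
      have hsub : ∀ j ≤ N, F^[j] ∅ ⊆ nest N b Φ (k + 1) X := by
        intro j hj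
        have := hchain hj
        simpa only [nest, hk, if_false] using this
      refine ⟨fun K x => if K = k then n x else
        n x * B + ρ (Function.update X k (F^[n x] ∅)) K x, fun K x => ?_, fun x hx => ?_⟩
      · have h1 := hnN x
        have h2 := hρB (Function.update X k (F^[n x] ∅)) K x
        have h3 : n x * B ≤ N * B := Nat.mul_le_mul_right _ h1
        simp only
        split_ifs <;> omega
      · obtain ⟨hxN, hxF⟩ := hspec x hx
        rw [Function.iterate_succ_apply'] at hxF
        refine hΦ (fun i => ?_) (hρ _ x hxF)
        intro y hy
        rcases lt_trichotomy i k with hi | rfl | hi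
        · simp only [hi.not_ge, if_false, Set.mem_ofPred_eq] at hy
          have h1 : ¬ k + 1 ≤ i := by omega
          simp only [h1, if_false, Set.mem_ofPred_eq]
          obtain ⟨hy1, hy2⟩ := hy
          have hyF : y ∈ F^[n x + 1] ∅ := by rw [Function.iterate_succ_apply']; exact hy1
          have hyn := hmin y _ hxN hyF
          refine ⟨hsub _ hxN hyF, fun K h2 h3 h4 => ?_⟩
          by_cases hK : K = k
          · simp only [hK, if_true, hi.ne', if_false]
            omega
          · simp only [hK, if_false]
            rcases hyn.lt_or_eq with h5 | h5
            · have h6 := hρB (Function.update X k (F^[n y] ∅)) K y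
              have h7 : (n y + 1) * B ≤ n x * B := Nat.mul_le_mul_right _ h5
              rw [Nat.add_mul, one_mul] at h7
              split_ifs <;> omega
            · have := hy2 K h2 (by omega) h4
              rw [h5]
              omega
        · simp only [le_refl, if_true, Function.update_self] at hy
          have h1 : ¬ i + 1 ≤ i := by omega
          simp only [h1, if_false, Set.mem_ofPred_eq]
          refine ⟨hsub _ hxN.le hy, fun K h2 h3 h4 => ?_⟩
          have hKi : K = i := by omega
          simp only [hKi, if_true]
          rcases hnx : n x with _ | j
          · rw [hnx] at hy; simp at hy
          · rw [hnx] at hy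
            have := hmin y j (by omega) hy
            omega
        · have h1 : k + 1 ≤ i := hi
          simp only [hi.le, if_true, Function.update_of_ne hi.ne'] at hy
          simpa only [h1, if_true] using hy

end NestedFixedPoints

/-! ### Sequences of priorities -/

section Recurrence

/-- `k` is the highest value that the sequence `c` takes infinitely often. -/
def IsMaxRecurring (c : ℕ → ℕ) (k : ℕ) : Prop :=
  (∃ᶠ i in atTop, c i = k) ∧ ∀ᶠ i in atTop, c i ≤ k

/-- A bounded sequence has a highest recurring value, its limit superior. -/
theorem exists_isMaxRecurring {c : ℕ → ℕ} {B : ℕ} (hc : ∀ i, c i < B) :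
    ∃ k, IsMaxRecurring c k := by
  classical
  have h : ∃ k, ∀ᶠ i in atTop, c i ≤ k := ⟨B, Eventually.of_forall fun i => (hc i).le⟩
  refine ⟨Nat.find h, ?_, Nat.find_spec h⟩
  intro hne
  rcases hk : Nat.find h with _ | k
  · have h2 := Nat.find_spec h
    rw [hk] at h2 hne
    obtain ⟨i, h3, h4⟩ := (hne.and h2).exists
    omega
  · have h2 := Nat.find_spec h
    rw [hk] at h2 hne
    refine Nat.find_min h (m := k) (by omega) ?_
    filter_upwards [hne, h2] with i h3 h4
    omega

theorem IsMaxRecurring.parityCondition_iff {c : ℕ → ℕ} {k : ℕ} (h : IsMaxRecurring c k) :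
    ParityCondition c ↔ Even k := by
  have hle : ∀ l, (∃ᶠ i in atTop, c i = l) → l ≤ k := by
    intro l hl
    obtain ⟨i, h1, h2⟩ := (hl.and_eventually h.2).exists
    omega
  constructor
  · rintro ⟨j, hj, hfreq, hmax⟩
    rwa [le_antisymm (hmax k h.1) (hle j hfreq)]
  · exact fun hk => ⟨k, hk, h.1, hle⟩

/-- A sequence of positions along which the ranks obey a progress measure: the highest recurring
priority cannot have the parity that the ranks guard. -/
theorem IsMaxRecurring.even_of_progress {V : Type*} {D b : ℕ} {ρ : ℕ → V → ℕ} {x : ℕ → V}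
    {π : ℕ → ℕ} {k : ℕ} (hk : IsMaxRecurring π k) (hD : ∀ t, π t < D)
    (h : ∀ t K, π t ≤ K → K < D → ¬ Even (K + b) →
      ρ K (x (t + 1)) + (if K = π t then 1 else 0) ≤ ρ K (x t)) : Even (k + b) := by
  by_contra hodd
  have hkD : k < D := by
    obtain ⟨t, ht⟩ := hk.1.exists
    exact ht ▸ hD t
  obtain ⟨T, hT⟩ := eventually_atTop.1 hk.2
  have anti : ∀ s t, T ≤ s → s ≤ t → ρ k (x t) ≤ ρ k (x s) := by
    intro s t hs hst
    induction t, hst using Nat.le_induction with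
    | base => exact le_rfl
    | succ t hst ih =>
      have := h t k (hT t (hs.trans hst)) hkD hodd
      omega
  have key : ∀ m, ∃ t, T ≤ t ∧ ρ k (x t) + m ≤ ρ k (x T) := by
    intro m
    induction m with
    | zero => exact ⟨T, le_rfl, by omega⟩
    | succ m ih =>
      obtain ⟨t, hTt, ht⟩ := ih
      obtain ⟨s, hts, hs⟩ := frequently_atTop.1 hk.1 t
      refine ⟨s + 1, by omega, ?_⟩
      have h1 := anti t s hTt hts
      have h2 := h s k hs.le hkD hodd
      simp only [hs, if_true] at h2
      omega
  obtain ⟨t, -, ht⟩ := key (ρ k (x T) + 1)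
  omega

/-- Dependent choice: a relation in which each element that is good at time `t` has a successor that
is good at time `t + 1` has an infinite path of good elements. -/
theorem exists_seq_of_step {α : Type*} {G : ℕ → α → Prop} {R : ℕ → α → α → Prop} {a₀ : α}
    (h₀ : G 0 a₀) (step : ∀ t a, G t a → ∃ a', G (t + 1) a' ∧ R t a a') :
    ∃ y : ℕ → α, y 0 = a₀ ∧ ∀ t, G t (y t) ∧ R t (y t) (y (t + 1)) := by
  choose g hg hR using step
  let y : ∀ t, {a // G t a} := fun t =>
    Nat.rec ⟨a₀, h₀⟩ (fun t a => ⟨g t a.1 a.2, hg t a.1 a.2⟩) t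
  exact ⟨fun t => (y t).1, rfl, fun t => ⟨(y t).2, hR t (y t).1 (y t).2⟩⟩

end Recurrence

/-! ### Records: the lexicographic order of two parity conditions -/

section Record

variable {n : ℕ}

/-- A record, the memory with which the two parity conditions of a simulation game become a single
one. Two sequences of priorities are read, `c` and `e`, and the entry at `i` is the highest value of
`e` since the last round in which `c` was at least `i`. Priorities range over `{0, …, n}`. -/
abbrev Record (n : ℕ) : Type := Fin (n + 1) → Fin (n + 1)

namespace Record

/-- The record after a round with the priorities `c` and `e`. -/
def next (m : Record n) (c e : Fin (n + 1)) : Record n :=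
  fun i => if i ≤ c then 0 else max (m i) e

/-- The priority of a round in the parity game on the positions with records. With `M` the highest
value of the second sequence since the last round in which the first one was at least `c`, the
priority encodes the lexicographic rank of the pair `(c, M)`; it is even if `c` is odd or `M` is
even. -/
def prio (m : Record n) (c e : Fin (n + 1)) : ℕ :=
  2 * ((n + 1) * c + (max (m c) e : Fin (n + 1))) +
    if Odd (c : ℕ) ∨ Even ((max (m c) e : Fin (n + 1)) : ℕ) then 0 else 1

theorem prio_lt (m : Record n) (c e : Fin (n + 1)) : m.prio c e < 2 * ((n + 1) * (n + 1)) := by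
  have h1 := (max (m c) e).isLt
  have h2 : (n + 1) * ((c : ℕ) + 1) ≤ (n + 1) * (n + 1) := Nat.mul_le_mul_left _ c.isLt
  rw [Nat.mul_add] at h2
  unfold prio
  split_ifs <;> omega

/-- If `I` and `J` are the highest recurring values of the two sequences, then the highest recurring
priority is the one of the pair `(I, J)`. It is even if and only if `I` is odd or `J` is even. -/
theorem isMaxRecurring_prio {c e : ℕ → Fin (n + 1)} {m : ℕ → Record n}
    (hm : ∀ t, m (t + 1) = (m t).next (c t) (e t)) {I J : ℕ}
    (hI : IsMaxRecurring (fun t => c t) I) (hJ : IsMaxRecurring (fun t => e t) J) :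
    IsMaxRecurring (fun t => (m t).prio (c t) (e t))
      (2 * ((n + 1) * I + J) + if Odd I ∨ Even J then 0 else 1) := by
  obtain ⟨T₀, hT₀⟩ := eventually_atTop.1 (hI.2.and hJ.2)
  obtain ⟨T₁, hT₁, hcT₁⟩ := frequently_atTop.1 hI.1 T₀
  simp only at hcT₁ hT₀
  have hcI : ∀ t, (c t : ℕ) = I ↔ c t = c T₁ := fun t => by rw [Fin.ext_iff, hcT₁]
  have hmJ : ∀ t, T₁ < t → ((m t (c T₁) : Fin (n + 1)) : ℕ) ≤ J := by
    intro t ht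
    induction t, ht using Nat.le_induction with
    | base => rw [hm]; simp [next]
    | succ t ht ih =>
      rw [hm]
      have := (hT₀ t (by omega)).2
      simp only [next]
      split_ifs
      · simp
      · rw [Fin.coe_max]
        exact max_le ih this
  have hval : ∀ t, T₁ < t → (c t : ℕ) = I → ((max (m t (c t)) (e t) : Fin (n + 1)) : ℕ) ≤ J := by
    intro t ht hc
    rw [Fin.coe_max, (hcI t).1 hc]
    exact max_le (hmJ t ht) (hT₀ t (by omega)).2
  constructor
  -- From a round `s` with `e s = J` on, the entry at `I` keeps the value `J` until the next round
  -- `u` in which `c` takes the value `I`.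
  · refine frequently_atTop.2 fun T => ?_
    obtain ⟨s, hs, hes⟩ := frequently_atTop.1 hJ.1 (max T (T₁ + 1))
    have hs1 : T ≤ s := (le_max_left _ _).trans hs
    have hs2 : T₁ + 1 ≤ s := (le_max_right _ _).trans hs
    classical
    have hex : ∃ u, s ≤ u ∧ (c u : ℕ) = I := frequently_atTop.1 hI.1 s
    obtain ⟨hu1, hu2⟩ := Nat.find_spec hex
    have hmin := fun v => Nat.find_min hex (m := v)
    set u := Nat.find hex
    have hge : ∀ v, s ≤ v → v ≤ u →
        J ≤ ((max (m v (c T₁)) (e v) : Fin (n + 1)) : ℕ) ∨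
          J ≤ ((m v (c T₁) : Fin (n + 1)) : ℕ) := by
      intro v hv
      induction v, hv using Nat.le_induction with
      | base => intro _; left; rw [Fin.coe_max]; exact le_max_of_le_right hes.ge
      | succ v hv ih =>
        intro hvu
        right
        have hlt : ¬ (c T₁ ≤ c v) := by
          have h1 := hmin v (by omega)
          have h2 := (hT₀ v (by omega)).1
          rw [Fin.le_def, hcT₁]
          omega
        rw [hm]
        simp only [next, hlt, if_false]
        rw [Fin.coe_max]
        rcases ih (by omega) with h | h
        · rwa [Fin.coe_max] at h
        · exact le_max_of_le_left h
    refine ⟨u, hs1.trans hu1, ?_⟩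
    have hJu : ((max (m u (c u)) (e u) : Fin (n + 1)) : ℕ) = J := by
      refine le_antisymm (hval u (by omega) hu2) ?_
      rw [(hcI u).1 hu2]
      rcases hge u hu1 le_rfl with h | h
      · exact h
      · rw [Fin.coe_max]; exact le_max_of_le_left h
    simp only [prio, hJu, hu2]
  · refine eventually_atTop.2 ⟨T₁ + 1, fun t ht => ?_⟩
    have hle := (hT₀ t (by omega)).1
    rcases hle.lt_or_eq with h | h
    · have h1 := (max (m t (c t)) (e t)).isLt
      have h2 : (n + 1) * ((c t : ℕ) + 1) ≤ (n + 1) * I := Nat.mul_le_mul_left _ h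
      rw [Nat.mul_add] at h2
      simp only [prio]
      split_ifs <;> omega
    · have h1 := hval t (by omega) h
      simp only [prio, h]
      rcases h1.lt_or_eq with h2 | h2
      · split_ifs <;> omega
      · rw [h2]

end Record
end Record

/-! ### The simulation game -/

section SimulationGame

variable {n : ℕ} {P S Q : Type*}

/-- The one-step operator of the simulation game. Its positions are a state of the first automaton,
a state of the second and a record. Adam moves in the first automaton and Eve answers in the second
one on the same letter; she can force the play, in one round of some priority `k`, into `Y k`. -/
def simStep (δA : P → S → P → Option (Fin (n + 1))) (δB : Q → S → Q → Option (Fin (n + 1)))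
    (Y : ℕ → Set (P × Q × Record n)) : Set (P × Q × Record n) :=
  {x | ∀ a p c, δA x.1 a p = some c → ∃ q e, δB x.2.1 a q = some e ∧
    (p, q, x.2.2.next c e) ∈ Y (x.2.2.prio c e)}

theorem simStep_mono (δA : P → S → P → Option (Fin (n + 1)))
    (δB : Q → S → Q → Option (Fin (n + 1))) : Monotone (simStep δA δB) := by
  intro Y Y' h x hx a p c hc
  obtain ⟨q, e, he, hY⟩ := hx a p c hc
  exact ⟨q, e, he, h _ hY⟩

/-- Eve's winning region of the simulation game, as a nested fixed point. It is meaningful if `N` is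
at least the number of positions. All variables are bound, so the values of the free ones do not
matter. -/
def simRegion (N : ℕ) (δA : P → S → P → Option (Fin (n + 1)))
    (δB : Q → S → Q → Option (Fin (n + 1))) : Set (P × Q × Record n) :=
  nest N 0 (simStep δA δB) (2 * ((n + 1) * (n + 1))) fun _ => ∅

/-- A positional winning strategy of Eve on her region, with ranks that descend at odd
priorities. -/
theorem exists_rank_of_simRegion [Fintype P] [Fintype Q] {N : ℕ}
    (δA : P → S → P → Option (Fin (n + 1))) (δB : Q → S → Q → Option (Fin (n + 1)))
    (hN : Fintype.card (P × Q × Record n) ≤ N) :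
    ∃ ρ : ℕ → P × Q × Record n → ℕ, ∀ x ∈ simRegion N δA δB, ∀ a p c, δA x.1 a p = some c →
      ∃ q e, δB x.2.1 a q = some e ∧ (p, q, x.2.2.next c e) ∈ simRegion N δA δB ∧
        ∀ K, x.2.2.prio c e ≤ K → K < 2 * ((n + 1) * (n + 1)) → ¬ Even (K + 0) →
          ρ K (p, q, x.2.2.next c e) + (if K = x.2.2.prio c e then 1 else 0) ≤ ρ K x := by
  obtain ⟨B, hB⟩ := exists_progressMeasure (b := 0) (simStep_mono δA δB) hN
    (2 * ((n + 1) * (n + 1)))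
  obtain ⟨ρ, -, hρ⟩ := hB fun _ => ∅
  refine ⟨ρ, fun x hx a p c hc => ?_⟩
  obtain ⟨q, e, he, hY⟩ := hρ x hx a p c hc
  simp only [(Record.prio_lt _ _ _).not_ge, if_false] at hY
  exact ⟨q, e, he, hY⟩

/-- A positional winning strategy of Adam outside of Eve's region, with ranks that descend at even
priorities. -/
theorem exists_rank_of_not_simRegion [Fintype P] [Fintype Q] {N : ℕ}
    (δA : P → S → P → Option (Fin (n + 1))) (δB : Q → S → Q → Option (Fin (n + 1)))
    (hN : Fintype.card (P × Q × Record n) ≤ N) :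
    ∃ ρ : ℕ → P × Q × Record n → ℕ, ∀ x ∉ simRegion N δA δB, ∃ a p c, δA x.1 a p = some c ∧
      ∀ q e, δB x.2.1 a q = some e → (p, q, x.2.2.next c e) ∉ simRegion N δA δB ∧
        ∀ K, x.2.2.prio c e ≤ K → K < 2 * ((n + 1) * (n + 1)) → ¬ Even (K + 1) →
          ρ K (p, q, x.2.2.next c e) + (if K = x.2.2.prio c e then 1 else 0) ≤ ρ K x := by
  have hmono : Monotone fun Y : ℕ → Set (P × Q × Record n) =>
      (simStep δA δB fun i => (Y i)ᶜ)ᶜ := fun Y Y' h =>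
    Set.compl_subset_compl.2 (simStep_mono δA δB fun i => Set.compl_subset_compl.2 (h i))
  obtain ⟨B, hB⟩ := exists_progressMeasure (b := 1) hmono hN (2 * ((n + 1) * (n + 1)))
  obtain ⟨ρ, -, hρ⟩ := hB fun _ => ∅ᶜ
  rw [← zero_add 1, ← nest_compl N 0 (simStep δA δB) _ fun _ => ∅] at hρ
  refine ⟨ρ, fun x hx => ?_⟩
  have hx' := hρ x hx
  simp only [simStep, Set.mem_compl_iff, Set.mem_ofPred_eq, not_forall, not_exists, not_and,
    not_not] at hx'
  obtain ⟨a, p, c, hc, h⟩ := hx'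
  refine ⟨a, p, c, hc, fun q e he => ?_⟩
  have hY := h q e he
  rw [if_neg (Record.prio_lt _ _ _).not_ge] at hY
  exact hY

end SimulationGame

/-! ### Containment of languages and the simulation game -/

section Containment

variable {P S Q : Type*} {d : ℕ}

/-- The transition function of an automaton with priorities in `[d]`. Its values lie in
`{0, …, d + 1}`, so that the priority `1` of the sink is available even if `d = 0`; `Fin.ofNat`
reduces larger priorities, which do not occur. -/
def boundedTrans (d : ℕ) (A : ParityAutomaton P S) (p : P) (a : S) (p' : P) :
    Option (Fin (d + 1 + 1)) :=
  (A.trans p a p').map (Fin.ofNat (d + 1 + 1))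

/-- The transition function of an automaton with a sink `none`, which can be reached from each state
on each letter, cannot be left, and is rejecting since its transitions have the priority `1`. With
it, Eve never gets stuck in the simulation game. -/
def sinkTrans (d : ℕ) (B : ParityAutomaton Q S) : Option Q → S → Option Q →
    Option (Fin (d + 1 + 1))
  | _, _, none => some 1
  | none, _, some _ => none
  | some q, a, some q' => boundedTrans d B q a q'

theorem boundedTrans_eq_some {A : ParityAutomaton P S} (hA : A.PrioritiesIn d) {p : P} {a : S}
    {p' : P} {c : Fin (d + 1 + 1)} :
    boundedTrans d A p a p' = some c ↔ A.trans p a p' = some (c : ℕ) := by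
  simp only [boundedTrans, Option.map_eq_some_iff]
  constructor
  · rintro ⟨k, hk, rfl⟩
    rw [hk, Fin.val_ofNat, Nat.mod_eq_of_lt]
    have := hA _ _ _ _ hk
    omega
  · intro h
    exact ⟨c, h, by ext; rw [Fin.val_ofNat, Nat.mod_eq_of_lt c.isLt]⟩

/-- If Eve wins the simulation game, then she can answer accepting runs of Adam by accepting runs.
She never enters the sink, as she would lose from there. -/
theorem language_subset_of_mem_simRegion [Fintype P] [Fintype Q] {A : ParityAutomaton P S}
    {B : ParityAutomaton Q S} (hA : A.PrioritiesIn d) (hB : B.PrioritiesIn d) {N : ℕ}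
    (hN : Fintype.card (P × Option Q × Record (d + 1)) ≤ N)
    (h : (A.init, some B.init, fun _ => 0) ∈ simRegion N (boundedTrans d A) (sinkTrans d B)) :
    A.language ⊆ B.language := by
  rintro w ⟨r, c, ⟨hr0, hr⟩, hc⟩
  obtain ⟨ρ, hρ⟩ := exists_rank_of_simRegion _ _ hN
  have hcd : ∀ t, c t ≤ d := fun t => hA _ _ _ _ (hr t)
  let c' : ℕ → Fin (d + 1 + 1) := fun t => ⟨c t, by have := hcd t; omega⟩
  obtain ⟨y, hy0, hy⟩ := exists_seq_of_step
    (G := fun t x => x ∈ simRegion N (boundedTrans d A) (sinkTrans d B) ∧ x.1 = r t)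
    (R := fun t x x' => ∃ e, sinkTrans d B x.2.1 (w t) x'.2.1 = some e ∧
      x'.2.2 = x.2.2.next (c' t) e ∧
        ∀ K, x.2.2.prio (c' t) e ≤ K → K < 2 * ((d + 1 + 1) * (d + 1 + 1)) → ¬ Even (K + 0) →
          ρ K x' + (if K = x.2.2.prio (c' t) e then 1 else 0) ≤ ρ K x)
    (a₀ := (A.init, some B.init, fun _ => 0)) ⟨h, hr0.symm⟩ (by
      rintro t x ⟨hxW, hx⟩
      obtain ⟨q, e, he, hW, hK⟩ := hρ x hxW (w t) (r (t + 1)) (c' t)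
        (by rw [boundedTrans_eq_some hA, hx]; exact hr t)
      exact ⟨_, ⟨hW, rfl⟩, e, he, rfl, hK⟩)
  choose hG e he hm hK using hy
  obtain ⟨I, hI⟩ := exists_isMaxRecurring (c := c) (B := d + 1) fun t => Nat.lt_succ_of_le (hcd t)
  obtain ⟨J, hJ⟩ := exists_isMaxRecurring (c := fun t => (e t : ℕ)) fun t => (e t).isLt
  have hπ := Record.isMaxRecurring_prio (c := c') (e := e) (m := fun t => (y t).2.2) hm hI hJ
  have heven := hπ.even_of_progress (fun t => Record.prio_lt _ _ _) hK
  have hIe := hI.parityCondition_iff.1 hc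
  have hJe : Even J := by
    by_contra hJo
    have : ¬ (Odd I ∨ Even J) := by simp [hJo, hIe]
    simp [this] at heven
  -- In the sink the play would stay, with the priority `1`.
  have hnone : ∀ t, (y t).2.1 ≠ none := by
    intro t ht
    have hstay : ∀ s, t ≤ s → (y s).2.1 = none := by
      intro s hs
      induction s, hs using Nat.le_induction with
      | base => exact ht
      | succ s hs ih =>
        have := he s
        rw [ih] at this
        rcases hq : (y (s + 1)).2.1 with _ | q
        · rfl
        · rw [hq] at this; simp [sinkTrans] at this
    have hone : ∀ s, t ≤ s → (e s : ℕ) = 1 := by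
      intro s hs
      have := he s
      rw [hstay s hs, hstay (s + 1) (by omega)] at this
      simp only [sinkTrans, Option.some.injEq] at this
      rw [← this]; simp
    obtain ⟨s, hs, hsJ⟩ := frequently_atTop.1 hJ.1 t
    simp only [hone s hs] at hsJ
    rw [← hsJ] at hJe
    simp at hJe
  choose s hs using fun t => Option.ne_none_iff_exists'.1 (hnone t)
  refine ⟨s, fun t => e t, ⟨?_, fun t => ?_⟩, hJ.parityCondition_iff.2 hJe⟩
  · have := hs 0
    rw [hy0] at this
    simpa using this.symm
  · have := he t
    rw [hs t, hs (t + 1)] at this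
    exact (boundedTrans_eq_some hB).1 this

/-- If Eve does not win the simulation game, then Adam does. Let his strategy play against Eve's
strategy of the letter game, with the rule that she moves to the sink if the letter game strategy
names a transition that does not exist. Adam's word is in the first language, hence in the second
one, so the letter game strategy builds an accepting run, the sink is avoided, and Eve wins the
play: a contradiction. -/
theorem mem_simRegion_of_language_subset [Fintype P] [Fintype Q] {A : ParityAutomaton P S}
    {B : ParityAutomaton Q S} (hA : A.PrioritiesIn d) (hB : B.PrioritiesIn d)
    (hHD : B.HistoryDeterministic) {N : ℕ}
    (hN : Fintype.card (P × Option Q × Record (d + 1)) ≤ N) (hsub : A.language ⊆ B.language) :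
    (A.init, some B.init, fun _ => 0) ∈ simRegion N (boundedTrans d A) (sinkTrans d B) := by
  classical
  by_contra h
  obtain ⟨σ, hσ⟩ := hHD
  obtain ⟨ρ, hρ⟩ := exists_rank_of_not_simRegion _ _ hN
  -- A stage of the play: the position of the game, Adam's word, Eve's states and her current state.
  obtain ⟨y, hy0, hy⟩ := exists_seq_of_step
    (G := fun _ z => z.1 ∉ simRegion N (boundedTrans d A) (sinkTrans d B))
    (R := fun _ (z z' : (P × Option Q × Record (d + 1)) × List S × List Q × Q) =>
      ∃ a c e, z'.2.1 = z.2.1 ++ [a] ∧ z'.2.2.2 = σ z'.2.1 z.2.2.1 ∧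
        z'.2.2.1 = z.2.2.1 ++ [z'.2.2.2] ∧ boundedTrans d A z.1.1 a z'.1.1 = some c ∧
        z'.1.2.1 = (if z.1.2.1 = some z.2.2.2 ∧ (B.trans z.2.2.2 a z'.2.2.2).isSome then
          some z'.2.2.2 else none) ∧
        sinkTrans d B z.1.2.1 a z'.1.2.1 = some e ∧ z'.1.2.2 = z.1.2.2.next c e ∧
        ∀ K, z.1.2.2.prio c e ≤ K → K < 2 * ((d + 1 + 1) * (d + 1 + 1)) → ¬ Even (K + 1) →
          ρ K z'.1 + (if K = z.1.2.2.prio c e then 1 else 0) ≤ ρ K z.1)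
    (a₀ := ((A.init, some B.init, fun _ => 0), [], [B.init], B.init)) h (by
      rintro t ⟨x, ws, rs, q⟩ hx
      obtain ⟨a, p, c, hc, hx'⟩ := hρ x hx
      set q' := σ (ws ++ [a]) rs with hq'
      have hex : ∃ e, sinkTrans d B x.2.1 a
          (if x.2.1 = some q ∧ (B.trans q a q').isSome then some q' else none) = some e := by
        split_ifs with hif
        · obtain ⟨e, he⟩ := Option.isSome_iff_exists.1 hif.2
          exact ⟨Fin.ofNat _ e, by rw [hif.1]; simp [sinkTrans, boundedTrans, he]⟩
        · exact ⟨1, by cases x.2.1 <;> rfl⟩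
      obtain ⟨e, he⟩ := hex
      obtain ⟨hW, hK⟩ := hx' _ e he
      exact ⟨(⟨p, _, x.2.2.next c e⟩, ws ++ [a], rs ++ [q'], q'), hW, a, c, e, rfl, rfl, rfl, hc,
        rfl, he, rfl, hK⟩)
  choose hG w c e hws hr hrs hc hq he hm hK using hy
  have hws' : ∀ t, (y t).2.1 = (List.range t).map w := by
    intro t
    induction t with
    | zero => simp [hy0]
    | succ t ih => rw [hws, ih, List.range_succ, List.map_append]; rfl
  have hrs' : ∀ t, (y t).2.2.1 = (List.range (t + 1)).map fun i => (y i).2.2.2 := by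
    intro t
    induction t with
    | zero => simp [hy0]
    | succ t ih => rw [hrs, ih, List.range_succ (n := t + 1), List.map_append]; rfl
  have hplay : B.IsLetterPlay σ w fun i => (y i).2.2.2 :=
    ⟨by simp [hy0], fun i => by simp only; rw [hr i, hws', hrs']⟩
  obtain ⟨I, hI⟩ := exists_isMaxRecurring (c := fun t => (c t : ℕ)) fun t => (c t).isLt
  obtain ⟨J, hJ⟩ := exists_isMaxRecurring (c := fun t => (e t : ℕ)) fun t => (e t).isLt
  have hπ := Record.isMaxRecurring_prio (m := fun t => (y t).1.2.2) hm hI hJ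
  have hodd := hπ.even_of_progress (x := fun t => (y t).1) (fun t => Record.prio_lt _ _ _) hK
  have hIJ : ¬ (Odd I ∨ Even J) := by
    intro hIJ
    simp [hIJ] at hodd
  have hwA : w ∈ A.language := by
    refine ⟨fun t => (y t).1.1, fun t => c t, ⟨by simp [hy0], fun t => ?_⟩, ?_⟩
    · exact (boundedTrans_eq_some hA).1 (hc t)
    · rw [hI.parityCondition_iff]
      exact Nat.not_odd_iff_even.1 fun h => hIJ (Or.inl h)
  obtain ⟨c', ⟨-, hrun⟩, hacc⟩ := hσ w _ hplay (hsub hwA)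
  have hqr : ∀ t, (y t).1.2.1 = some (y t).2.2.2 := by
    intro t
    induction t with
    | zero => simp [hy0]
    | succ t ih => rw [hq t, if_pos ⟨ih, by rw [hrun t]; rfl⟩]
  have hec : c' = fun t => (e t : ℕ) := by
    funext t
    have h1 := he t
    rw [hqr t, hqr (t + 1)] at h1
    have h2 := (boundedTrans_eq_some hB).1 h1
    rw [hrun t] at h2
    exact Option.some.inj h2
  rw [hec, hJ.parityCondition_iff] at hacc
  exact hIJ (Or.inr hacc)

end Containment

/-! ### Structured programs on tapes and their compilation to Turing machines -/

section TapePrograms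

/-- A configuration of a machine with tapes indexed by `K`, each of them infinite to the right, with
the tape alphabet `Γ` and the finite memory `σ`. -/
structure TapeState (K Γ σ : Type) where
  /-- the finite memory -/
  mem : σ
  /-- the contents of the tapes -/
  cell : K → ℕ → Γ
  /-- the positions of the heads -/
  head : K → ℕ

/-- Structured programs on tapes. The only loop is a counted one, with as many rounds as the input
has letters, so that each program runs in polynomial time. -/
inductive TapeProg (K Γ σ : Type) : Type
  /-- move a head to the left; at the left end it stays -/
  | left (k : K)
  /-- move a head to the right -/
  | right (k : K)
  /-- read the scanned cell into the memory -/
  | read (k : K) (f : σ → Γ → σ)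
  /-- overwrite the scanned cell -/
  | write (k : K) (f : σ → Γ)
  /-- sequential composition -/
  | seq (p q : TapeProg K Γ σ)
  /-- branching on the memory -/
  | ite (c : σ → Bool) (p q : TapeProg K Γ σ)
  /-- repetition, as many times as the input has letters -/
  | loop (p : TapeProg K Γ σ)

namespace TapeProg

variable {K Γ σ : Type}

/-- Running a program on an input of length `L`. -/
def run [DecidableEq K] (L : ℕ) : TapeProg K Γ σ → TapeState K Γ σ → TapeState K Γ σ
  | left k, s => { s with head := Function.update s.head k (s.head k - 1) }
  | right k, s => { s with head := Function.update s.head k (s.head k + 1) }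
  | read k f, s => { s with mem := f s.mem (s.cell k (s.head k)) }
  | write k f, s =>
    { s with cell := Function.update s.cell k (Function.update (s.cell k) (s.head k) (f s.mem)) }
  | seq p q, s => run L q (run L p s)
  | ite c p q, s => if c s.mem then run L p s else run L q s
  | loop p, s => (run L p)^[L] s

/-- A bound on the running time of the compiled program, as a polynomial in the length of the
input. -/
noncomputable def cost : TapeProg K Γ σ → Polynomial ℕ
  | left _ => 1
  | right _ => 1
  | read _ _ => 1
  | write _ _ => 1
  | seq p q => cost p + cost q
  | ite _ p q => 1 + (cost p + cost q)
  | loop p => 4 + 3 * .X + .X * cost p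

/-- The labels of the compiled program. A loop has four labels of its own: its entry, the two passes
that copy the clock, and the test for another round. -/
def Label : TapeProg K Γ σ → Type
  | left _ => Unit
  | right _ => Unit
  | read _ _ => Unit
  | write _ _ => Unit
  | seq p q => Label p ⊕ Label q
  | ite _ p q => Unit ⊕ (Label p ⊕ Label q)
  | loop p => Fin 4 ⊕ Label p

/-- The label at which the compiled program starts. -/
def entry : (p : TapeProg K Γ σ) → Label p
  | left _ => ()
  | right _ => ()
  | read _ _ => ()
  | write _ _ => ()
  | seq p _ => .inl (entry p)
  | ite _ _ _ => .inl ()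
  | loop _ => .inl 0

theorem finite_label (p : TapeProg K Γ σ) : Finite (Label p) := by
  induction p with
  | seq p q hp hq => exact inferInstanceAs (Finite (Label p ⊕ Label q))
  | ite c p q hp hq => exact inferInstanceAs (Finite (Unit ⊕ (Label p ⊕ Label q)))
  | loop p hp => exact inferInstanceAs (Finite (Fin 4 ⊕ Label p))
  | _ => exact inferInstanceAs (Finite Unit)

/-- The stacks of the compiled program: a tape consists of the stack `(k, false)` of the cells to
the left of its head and the stack `(k, true)` of the cells from the head on. Of the other four,
stack `0` is for input and output, stack `1` is a clock with as many elements as the input has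
letters, stack `2` is an auxiliary clock, and stack `3` holds the remaining rounds of the active
loops. -/
abbrev Stack (K : Type) : Type := (K × Bool) ⊕ Fin 4

/-- The stack alphabets: the tape alphabet on the tapes, bits elsewhere. -/
abbrev StackAlphabet (K Γ : Type) : Stack K → Type
  | .inl _ => Γ
  | .inr _ => Bool

/-- The finite store of the compiled program: the memory, and buffers for a cell and for a bit that
have been taken from a stack. -/
abbrev Register (Γ σ : Type) : Type := σ × Option Γ × Option Bool

variable [Inhabited Γ]

open Turing.TM2.Stmt

/-- The compiled program, which is placed at the labels `emb l` and jumps to `exit` when it is done.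
A loop puts `false` and then a copy of the clock on stack `3`, restores the clock, and runs a round
for each `true` that it removes from stack `3` until it meets `false`. -/
def code {Λ : Type} : (p : TapeProg K Γ σ) → (Label p → Λ) → Λ → Label p →
    Turing.TM2.Stmt (StackAlphabet K Γ) Λ (Register Γ σ)
  | left k, _, exit, _ =>
    pop (.inl (k, false)) (fun v o => (v.1, o, v.2.2)) <|
    branch (fun v => v.2.1.isSome)
      (push (.inl (k, true)) (fun v => v.2.1.getD (default : Γ)) <| goto fun _ => exit)
      (goto fun _ => exit)
  | right k, _, exit, _ =>
    pop (.inl (k, true)) (fun v o => (v.1, o, v.2.2)) <|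
    push (.inl (k, false)) (fun v => v.2.1.getD (default : Γ)) <|
    goto fun _ => exit
  | read k f, _, exit, _ =>
    peek (.inl (k, true)) (fun v o => (f v.1 (o.getD (default : Γ)), v.2)) <|
    goto fun _ => exit
  | write k f, _, exit, _ =>
    pop (.inl (k, true)) (fun v _ => v) <|
    push (.inl (k, true)) (fun v => f v.1) <|
    goto fun _ => exit
  | seq p q, emb, exit, l =>
    match l with
    | .inl l => code p (fun l => emb (.inl l)) (emb (.inr (entry q))) l
    | .inr l => code q (fun l => emb (.inr l)) exit l
  | ite c p q, emb, exit, l =>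
    match l with
    | .inl _ => branch (fun v => c v.1) (goto fun _ => emb (.inr (.inl (entry p))))
        (goto fun _ => emb (.inr (.inr (entry q))))
    | .inr (.inl l) => code p (fun l => emb (.inr (.inl l))) exit l
    | .inr (.inr l) => code q (fun l => emb (.inr (.inr l))) exit l
  | loop p, emb, exit, l =>
    match l with
    | .inl 0 => push (.inr 3) (fun _ => false) <| goto fun _ => emb (.inl 1)
    | .inl 1 =>
      pop (.inr 1) (fun v o => (v.1, v.2.1, o)) <|
      branch (fun v => v.2.2.isSome)
        (push (.inr 2) (fun _ => true) <| push (.inr 3) (fun _ => true) <|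
          goto fun _ => emb (.inl 1))
        (goto fun _ => emb (.inl 2))
    | .inl 2 =>
      pop (.inr 2) (fun v o => (v.1, v.2.1, o)) <|
      branch (fun v => v.2.2.isSome)
        (push (.inr 1) (fun _ => true) <| goto fun _ => emb (.inl 2))
        (goto fun _ => emb (.inl 3))
    | .inl 3 =>
      pop (.inr 3) (fun v o => (v.1, v.2.1, o)) <|
      branch (fun v => v.2.2 = some true) (goto fun _ => emb (.inr (entry p)))
        (goto fun _ => exit)
    | .inr l => code p (fun l => emb (.inr l)) (emb (.inl 3)) l

/-- The machine `M` gets from `c` to `c'` in exactly `t` steps. -/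
def Steps {Λ : Type} [DecidableEq K]
    (M : Λ → Turing.TM2.Stmt (StackAlphabet K Γ) Λ (Register Γ σ)) (t : ℕ)
    (c c' : Turing.TM2.Cfg (StackAlphabet K Γ) Λ (Register Γ σ)) : Prop :=
  (flip Bind.bind (Turing.TM2.step M))^[t] (some c) = some c'

section Steps

variable {Λ : Type} [DecidableEq K] {M : Λ → Turing.TM2.Stmt (StackAlphabet K Γ) Λ (Register Γ σ)}

omit [Inhabited Γ] in
theorem Steps.trans {t t' : ℕ} {c c' c'' : Turing.TM2.Cfg (StackAlphabet K Γ) Λ (Register Γ σ)}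
    (h : Steps M t c c') (h' : Steps M t' c' c'') : Steps M (t + t') c c'' := by
  unfold Steps at *
  rw [add_comm, Function.iterate_add_apply, h, h']

omit [Inhabited Γ] in
theorem steps_one {l : Λ} {q : Turing.TM2.Stmt (StackAlphabet K Γ) Λ (Register Γ σ)}
    (h : M l = q) (v : Register Γ σ) (S : ∀ k, List (StackAlphabet K Γ k)) :
    Steps M 1 ⟨some l, v, S⟩ (Turing.TM2.stepAux q v S) := h ▸ rfl

end Steps

/-- The registers `v` and the stacks `S` represent the configuration `s`, with `a` elements left on
the clock, `b` elements on the auxiliary clock and `F` on the stack of the active loops. Cells below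
the bottom of a stack count as default cells. -/
structure Represents (a b : ℕ) (F : List Bool) (s : TapeState K Γ σ) (v : Register Γ σ)
    (S : ∀ k, List (StackAlphabet K Γ k)) : Prop where
  mem : v.1 = s.mem
  left : ∀ k, S (.inl (k, false)) = (List.range (s.head k)).reverse.map (s.cell k)
  right : ∀ k (i : ℕ), (S (.inl (k, true)))[i]?.getD (default : Γ) = s.cell k (s.head k + i)
  io : S (.inr 0) = []
  ticks : S (.inr 1) = List.replicate a true
  spent : S (.inr 2) = List.replicate b true
  frames : S (.inr 3) = F

variable [DecidableEq K] {Λ : Type} {M : Λ → Turing.TM2.Stmt (StackAlphabet K Γ) Λ (Register Γ σ)}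

omit [DecidableEq K] in
theorem Represents.getD_head? {a b : ℕ} {F : List Bool} {s : TapeState K Γ σ} {v : Register Γ σ}
    {S : ∀ k, List (StackAlphabet K Γ k)} (h : Represents a b F s v S) (k : K) :
    (S (.inl (k, true))).head?.getD (default : Γ) = s.cell k (s.head k) := by
  have := h.right k 0
  rwa [← List.head?_eq_getElem?] at this

theorem steps_left {a b : ℕ} {F : List Bool} {s : TapeState K Γ σ} {v : Register Γ σ}
    {S : ∀ k, List (StackAlphabet K Γ k)} (h : Represents a b F s v S) {k : K} {l : Λ} {exit : Λ}
    (hM : M l = code (left k) (fun _ => l) exit ()) :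
    ∃ v' S', Steps M 1 ⟨some l, v, S⟩ ⟨some exit, v', S'⟩ ∧
      Represents a b F ((left k).run 0 s) v' S' ∧
      ∀ k, (S' (.inl k)).length ≤ (S (.inl k)).length + 1 := by
  have h1 := steps_one hM v S
  simp only [code, Turing.TM2.stepAux] at h1
  have hl := h.left k
  rcases hk : s.head k with _ | j
  · rw [hk] at hl
    simp only [hl, List.range_zero, List.reverse_nil, List.map_nil, List.head?_nil,
      Option.isSome_none, cond_false] at h1
    rw [List.tail_nil, ← (show S (.inl (k, false)) = [] from hl), Function.update_eq_self] at h1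
    refine ⟨_, _, h1, ?_, fun k => Nat.le_succ _⟩
    have : (left k).run 0 s = s := by
      have h0 : s.head k - 1 = s.head k := by omega
      simp only [run, h0, Function.update_eq_self]
    rw [this]
    exact ⟨h.mem, h.left, h.right, h.io, h.ticks, h.spent, h.frames⟩
  · rw [hk, List.range_succ, List.reverse_append, List.reverse_singleton, List.map_append] at hl
    simp only [hl] at h1
    refine ⟨_, _, h1, ⟨h.mem, fun k' => ?_, fun k' i => ?_, ?_, ?_, ?_, ?_⟩, fun k' => ?_⟩
    · by_cases hkk : k' = k
      · subst hkk; simp [run, hk]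
      · simp [run, hkk, h.left]
    · by_cases hkk : k' = k
      · subst hkk
        have := h.right k'
        rw [hk] at this
        rcases i with _ | i
        · simp [run, hk]
        · simp only [Function.update_self, List.getElem?_cons_succ, ne_eq, Sum.inl.injEq,
            Prod.mk.injEq, Bool.true_eq_false, and_false, not_false_eq_true,
            Function.update_of_ne, this]
          simp only [run, Function.update_self, hk]
          simp only [Nat.add_sub_cancel]
          congr 1
          omega
      · simpa [run, hkk] using h.right k' i
    · simpa using h.io
    · simpa using h.ticks
    · simpa using h.spent
    · simpa using h.frames
    · rcases k' with ⟨k', _ | _⟩ <;> by_cases hkk : k' = k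
      · subst hkk; simp [hl]; omega
      · simp [hkk]
      · subst hkk; simp
      · simp [hkk]

theorem steps_right {a b : ℕ} {F : List Bool} {s : TapeState K Γ σ} {v : Register Γ σ}
    {S : ∀ k, List (StackAlphabet K Γ k)} (h : Represents a b F s v S) {k : K} {l : Λ} {exit : Λ}
    (hM : M l = code (right k) (fun _ => l) exit ()) :
    ∃ v' S', Steps M 1 ⟨some l, v, S⟩ ⟨some exit, v', S'⟩ ∧
      Represents a b F ((right k).run 0 s) v' S' ∧
      ∀ k, (S' (.inl k)).length ≤ (S (.inl k)).length + 1 := by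
  have h1 := steps_one hM v S
  simp only [code, Turing.TM2.stepAux] at h1
  refine ⟨_, _, h1, ⟨h.mem, fun k' => ?_, fun k' i => ?_, ?_, ?_, ?_, ?_⟩, fun k' => ?_⟩
  · by_cases hkk : k' = k
    · subst hkk
      have := h.getD_head? k'
      simp [run, List.range_succ, h.left, this]
    · simp [run, hkk, h.left]
  · by_cases hkk : k' = k
    · subst hkk
      have := h.right k' (i + 1)
      simp [run, this]
      congr 1
      omega
    · simpa [run, hkk] using h.right k' i
  · simpa using h.io
  · simpa using h.ticks
  · simpa using h.spent
  · simpa using h.frames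
  · rcases k' with ⟨k', _ | _⟩ <;> by_cases hkk : k' = k
    · subst hkk; simp
    · simp [hkk]
    · subst hkk; simp; omega
    · simp [hkk]

theorem steps_read {a b : ℕ} {F : List Bool} {s : TapeState K Γ σ} {v : Register Γ σ}
    {S : ∀ k, List (StackAlphabet K Γ k)} (h : Represents a b F s v S) {k : K} {f : σ → Γ → σ}
    {l : Λ} {exit : Λ} (hM : M l = code (read k f) (fun _ => l) exit ()) :
    ∃ v' S', Steps M 1 ⟨some l, v, S⟩ ⟨some exit, v', S'⟩ ∧
      Represents a b F ((read k f).run 0 s) v' S' ∧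
      ∀ k, (S' (.inl k)).length ≤ (S (.inl k)).length + 1 := by
  have h1 := steps_one hM v S
  simp only [code, Turing.TM2.stepAux] at h1
  refine ⟨_, _, h1, ⟨?_, h.left, h.right, h.io, h.ticks, h.spent, h.frames⟩, fun k => by omega⟩
  simp only [run]
  rw [← h.mem, ← h.getD_head? k]

theorem steps_write {a b : ℕ} {F : List Bool} {s : TapeState K Γ σ} {v : Register Γ σ}
    {S : ∀ k, List (StackAlphabet K Γ k)} (h : Represents a b F s v S) {k : K} {f : σ → Γ}
    {l : Λ} {exit : Λ} (hM : M l = code (write k f) (fun _ => l) exit ()) :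
    ∃ v' S', Steps M 1 ⟨some l, v, S⟩ ⟨some exit, v', S'⟩ ∧
      Represents a b F ((write k f).run 0 s) v' S' ∧
      ∀ k, (S' (.inl k)).length ≤ (S (.inl k)).length + 1 := by
  have h1 := steps_one hM v S
  simp only [code, Turing.TM2.stepAux] at h1
  refine ⟨_, _, h1, ⟨h.mem, fun k' => ?_, fun k' i => ?_, ?_, ?_, ?_, ?_⟩, fun k' => ?_⟩
  · by_cases hkk : k' = k
    · subst hkk
      simp only [run, Function.update_self, ne_eq, Sum.inl.injEq, Prod.mk.injEq,
        Bool.false_eq_true, and_false, not_false_eq_true, Function.update_of_ne, h.left]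
      refine List.map_congr_left fun i hi => ?_
      have : i < s.head k' := by simpa using hi
      rw [Function.update_of_ne this.ne]
    · simp [run, hkk, h.left]
  · by_cases hkk : k' = k
    · subst hkk
      rcases i with _ | i
      · simp [run, h.mem]
      · have := h.right k' (i + 1)
        simp [run, this]
    · simpa [run, hkk] using h.right k' i
  · simpa using h.io
  · simpa using h.ticks
  · simpa using h.spent
  · simpa using h.frames
  · rcases k' with ⟨k', _ | _⟩ <;> by_cases hkk : k' = k
    · subst hkk; simp
    · simp [hkk]
    · subst hkk; simp; try omega
    · simp [hkk]

/-- The first pass of a loop moves the clock to stack `2` and copies it to stack `3`. -/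
theorem steps_fill {p : TapeProg K Γ σ} {emb : Label (loop p) → Λ} {exit : Λ}
    (hM : ∀ l, M (emb l) = code (loop p) emb exit l) {s : TapeState K Γ σ} (a : ℕ) {b : ℕ}
    {F : List Bool} {v : Register Γ σ} {S : ∀ k, List (StackAlphabet K Γ k)}
    (h : Represents a b F s v S) :
    ∃ v' S', Steps M (a + 1) ⟨some (emb (.inl 1)), v, S⟩ ⟨some (emb (.inl 2)), v', S'⟩ ∧
      Represents 0 (b + a) (List.replicate a true ++ F) s v' S' ∧
      ∀ k, S' (.inl k) = S (.inl k) := by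
  induction a generalizing b F v S with
  | zero =>
    have h1 := steps_one (hM (.inl 1)) v S
    simp only [code, Turing.TM2.stepAux, h.ticks, List.replicate_zero, List.head?_nil,
      Option.isSome_none, cond_false, List.tail_nil] at h1
    refine ⟨_, _, h1, ⟨h.mem, ?_, ?_, ?_, ?_, ?_, ?_⟩, fun k => ?_⟩
    · simpa using h.left
    · simpa using h.right
    · simpa using h.io
    · simp
    · simpa using h.spent
    · simpa using h.frames
    · simp
  | succ a ih =>
    have h1 := steps_one (hM (.inl 1)) v S
    simp only [code, Turing.TM2.stepAux, h.ticks, List.replicate_succ, List.head?_cons,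
      Option.isSome_some, cond_true, List.tail_cons] at h1
    obtain ⟨S₁, hS₁, hl₁, h2⟩ : ∃ S₁, Steps M 1 ⟨some (emb (.inl 1)), v, S⟩
          ⟨some (emb (.inl 1)), (v.1, v.2.1, some true), S₁⟩ ∧
        (∀ k, S₁ (.inl k) = S (.inl k)) ∧
        Represents a (b + 1) (true :: F) s (v.1, v.2.1, some true) S₁ := by
      refine ⟨_, h1, fun k => by simp, h.mem, ?_, ?_, ?_, ?_, ?_, ?_⟩
      · simpa using h.left
      · simpa using h.right
      · simpa using h.io
      · simp
      · simpa [List.replicate_succ] using h.spent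
      · simpa using h.frames
    obtain ⟨v', S', hS, hR, hl⟩ := ih h2
    rw [add_comm (a + 1) 1]
    refine ⟨v', S', hS₁.trans hS, ?_, fun k => (hl k).trans (hl₁ k)⟩
    rw [List.replicate_succ', List.append_assoc, show b + (a + 1) = b + 1 + a by ring]
    exact hR

/-- The second pass of a loop moves stack `2` back to the clock. -/
theorem steps_refill {p : TapeProg K Γ σ} {emb : Label (loop p) → Λ} {exit : Λ}
    (hM : ∀ l, M (emb l) = code (loop p) emb exit l) {s : TapeState K Γ σ} {a : ℕ} (b : ℕ)
    {F : List Bool} {v : Register Γ σ} {S : ∀ k, List (StackAlphabet K Γ k)}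
    (h : Represents a b F s v S) :
    ∃ v' S', Steps M (b + 1) ⟨some (emb (.inl 2)), v, S⟩ ⟨some (emb (.inl 3)), v', S'⟩ ∧
      Represents (a + b) 0 F s v' S' ∧ ∀ k, S' (.inl k) = S (.inl k) := by
  induction b generalizing a v S with
  | zero =>
    have h1 := steps_one (hM (.inl 2)) v S
    simp only [code, Turing.TM2.stepAux, h.spent, List.replicate_zero, List.head?_nil,
      Option.isSome_none, cond_false, List.tail_nil] at h1
    refine ⟨_, _, h1, ⟨h.mem, ?_, ?_, ?_, ?_, ?_, ?_⟩, fun k => ?_⟩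
    · simpa using h.left
    · simpa using h.right
    · simpa using h.io
    · simpa using h.ticks
    · simp
    · simpa using h.frames
    · simp
  | succ b ih =>
    have h1 := steps_one (hM (.inl 2)) v S
    simp only [code, Turing.TM2.stepAux, h.spent, List.replicate_succ, List.head?_cons,
      Option.isSome_some, cond_true, List.tail_cons] at h1
    obtain ⟨S₁, hS₁, hl₁, h2⟩ : ∃ S₁, Steps M 1 ⟨some (emb (.inl 2)), v, S⟩
          ⟨some (emb (.inl 2)), (v.1, v.2.1, some true), S₁⟩ ∧
        (∀ k, S₁ (.inl k) = S (.inl k)) ∧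
        Represents (a + 1) b F s (v.1, v.2.1, some true) S₁ := by
      refine ⟨_, h1, fun k => by simp, h.mem, ?_, ?_, ?_, ?_, ?_, ?_⟩
      · simpa using h.left
      · simpa using h.right
      · simpa using h.io
      · simpa [List.replicate_succ] using h.ticks
      · simp
      · simpa using h.frames
    obtain ⟨v', S', hS, hR, hl⟩ := ih h2
    rw [add_comm (b + 1) 1]
    refine ⟨v', S', hS₁.trans hS, ?_, fun k => (hl k).trans (hl₁ k)⟩
    rw [show a + (b + 1) = a + 1 + b by ring]
    exact hR

/-- The compiled program computes what the program does, within its cost. The bound on the stacks is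
what the time for clearing them depends on. -/
theorem steps_code {L : ℕ} (p : TapeProg K Γ σ) {emb : Label p → Λ} {exit : Λ}
    (hM : ∀ l, M (emb l) = code p emb exit l) {F : List Bool} {s : TapeState K Γ σ}
    {v : Register Γ σ} {S : ∀ k, List (StackAlphabet K Γ k)} (h : Represents L 0 F s v S) :
    ∃ t ≤ p.cost.eval L, ∃ v' S', Steps M t ⟨some (emb p.entry), v, S⟩ ⟨some exit, v', S'⟩ ∧
      Represents L 0 F (p.run L s) v' S' ∧
      ∀ k, (S' (.inl k)).length ≤ (S (.inl k)).length + t := by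
  induction p generalizing F s v S exit with
  | left k => exact ⟨1, by simp [cost], steps_left h (hM ())⟩
  | right k => exact ⟨1, by simp [cost], steps_right h (hM ())⟩
  | read k f => exact ⟨1, by simp [cost], steps_read h (hM ())⟩
  | write k f => exact ⟨1, by simp [cost], steps_write h (hM ())⟩
  | seq p q ihp ihq =>
    obtain ⟨t, ht, v₁, S₁, hS, hR, hl⟩ := ihp (fun l => hM (.inl l)) h
    obtain ⟨t', ht', v₂, S₂, hS', hR', hl'⟩ := ihq (fun l => hM (.inr l)) hR
    refine ⟨t + t', by simpa [cost] using add_le_add ht ht', v₂, S₂, hS.trans hS', hR', fun k => ?_⟩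
    have := hl k
    have := hl' k
    omega
  | ite c p q ihp ihq =>
    have h1 := steps_one (hM (.inl ())) v S
    simp only [code, Turing.TM2.stepAux, h.mem] at h1
    rcases hc : c s.mem with _ | _
    · obtain ⟨t, ht, v₁, S₁, hS, hR, hl⟩ := ihq (fun l => hM (.inr (.inr l))) h
      rw [hc] at h1
      refine ⟨1 + t, ?_, v₁, S₁, h1.trans hS, by simpa [run, hc] using hR, fun k => ?_⟩
      · simp only [cost, Polynomial.eval_add, Polynomial.eval_one]; omega
      · have := hl k; omega
    · obtain ⟨t, ht, v₁, S₁, hS, hR, hl⟩ := ihp (fun l => hM (.inr (.inl l))) h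
      rw [hc] at h1
      refine ⟨1 + t, ?_, v₁, S₁, h1.trans hS, by simpa [run, hc] using hR, fun k => ?_⟩
      · simp only [cost, Polynomial.eval_add, Polynomial.eval_one]; omega
      · have := hl k; omega
  | loop p ih =>
    have body : ∀ (j : ℕ) {s : TapeState K Γ σ} {v : Register Γ σ}
        {S : ∀ k, List (StackAlphabet K Γ k)},
        Represents L 0 (List.replicate j true ++ false :: F) s v S →
        ∃ t ≤ 1 + j * (1 + p.cost.eval L), ∃ v' S',
          Steps M t ⟨some (emb (.inl 3)), v, S⟩ ⟨some exit, v', S'⟩ ∧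
          Represents L 0 F ((p.run L)^[j] s) v' S' ∧
          ∀ k, (S' (.inl k)).length ≤ (S (.inl k)).length + t := by
      intro j
      induction j with
      | zero =>
        intro s v S h
        have h1 := steps_one (hM (.inl 3)) v S
        simp only [code, Turing.TM2.stepAux, h.frames, List.replicate_zero, List.nil_append,
          List.head?_cons, List.tail_cons, Option.some.injEq, Bool.false_eq_true, decide_false,
          cond_false] at h1
        refine ⟨1, by simp, _, _, h1, ⟨h.mem, ?_, ?_, ?_, ?_, ?_, ?_⟩, fun k => ?_⟩
        · simpa using h.left
        · simpa using h.right
        · simpa using h.io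
        · simpa using h.ticks
        · simpa using h.spent
        · simp
        · simp
      | succ j ihj =>
        intro s v S h
        have h1 := steps_one (hM (.inl 3)) v S
        simp only [code, Turing.TM2.stepAux, h.frames, List.replicate_succ, List.cons_append,
          List.head?_cons, List.tail_cons, decide_true, cond_true] at h1
        obtain ⟨S₀, hS₀, hl₀, h2⟩ : ∃ S₀, Steps M 1 ⟨some (emb (.inl 3)), v, S⟩
              ⟨some (emb (.inr p.entry)), (v.1, v.2.1, some true), S₀⟩ ∧
            (∀ k, S₀ (.inl k) = S (.inl k)) ∧ Represents L 0 (List.replicate j true ++ false :: F) s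
              (v.1, v.2.1, some true) S₀ := by
          refine ⟨_, h1, fun k => by simp, h.mem, ?_, ?_, ?_, ?_, ?_, ?_⟩
          · simpa using h.left
          · simpa using h.right
          · simpa using h.io
          · simpa using h.ticks
          · simpa using h.spent
          · simp
        obtain ⟨t, ht, v₁, S₁, hS, hR, hl⟩ := ih (fun l => hM (.inr l)) h2
        obtain ⟨t', ht', v₂, S₂, hS', hR', hl'⟩ := ihj hR
        refine ⟨1 + t + t', ?_, v₂, S₂, (hS₀.trans hS).trans hS', hR', fun k => ?_⟩
        · rw [Nat.add_mul]
          omega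
        · have := hl k
          have := hl' k
          rw [hl₀] at *
          omega
    have h1 := steps_one (hM (.inl 0)) v S
    simp only [code, Turing.TM2.stepAux] at h1
    obtain ⟨S₀, hS₀, hl₀, h2⟩ : ∃ S₀, Steps M 1 ⟨some (emb (.inl 0)), v, S⟩
          ⟨some (emb (.inl 1)), v, S₀⟩ ∧
        (∀ k, S₀ (.inl k) = S (.inl k)) ∧ Represents L 0 (false :: F) s v S₀ := by
      refine ⟨_, h1, fun k => by simp, h.mem, ?_, ?_, ?_, ?_, ?_, ?_⟩
      · simpa using h.left
      · simpa using h.right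
      · simpa using h.io
      · simpa using h.ticks
      · simpa using h.spent
      · simpa using h.frames
    obtain ⟨v₁, S₁, hS₁, hR₁, hl₁⟩ := steps_fill hM L h2
    obtain ⟨v₂, S₂, hS₂, hR₂, hl₂⟩ := steps_refill hM _ hR₁
    rw [zero_add, zero_add] at hR₂
    obtain ⟨t, ht, v₃, S₃, hS₃, hR₃, hl₃⟩ := body L hR₂
    refine ⟨_, ?_, v₃, S₃, ((hS₀.trans hS₁).trans hS₂).trans hS₃, hR₃, fun k => ?_⟩
    · simp only [cost, Polynomial.eval_add, Polynomial.eval_mul, Polynomial.eval_ofNat,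
        Polynomial.eval_X]
      rw [Nat.mul_add] at ht
      omega
    · have := hl₃ k
      rw [hl₂, hl₁, hl₀] at this
      omega

end TapeProg
end TapePrograms

/-! ### The Turing machine of a structured program -/

section TapeMachine

namespace TapeProg

variable {K Γ σ : Type} [Inhabited Γ] [DecidableEq K] [Fintype K]

open Turing.TM2.Stmt

/-- Remove the top element of each stack in a list, record in the bit buffer whether there was one,
and go on with `q`. -/
def popAll {Λ : Type} (q : Turing.TM2.Stmt (StackAlphabet K Γ) Λ (Register Γ σ)) :
    List (Stack K) → Turing.TM2.Stmt (StackAlphabet K Γ) Λ (Register Γ σ)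
  | [] => q
  | k :: ks => pop k (fun v o => (v.1, v.2.1, if o.isSome then some true else v.2.2)) (popAll q ks)

/-- The machine that runs the program `p`: move the input, letter by letter, to the left half of the
tape `input` while filling the clock, run `p`, clear the stacks, and output the answer `ans` that
the memory gives. -/
noncomputable def machineCode (p : TapeProg K Γ σ) (input : K) (sym : Bool → Γ) (m₀ : σ)
    (ans : σ → Bool) : Fin 3 ⊕ Label p →
      Turing.TM2.Stmt (StackAlphabet K Γ) (Fin 3 ⊕ Label p) (Register Γ σ)
  | .inl 0 =>
    pop (.inr 0) (fun v o => (v.1, v.2.1, o)) <|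
    branch (fun v => v.2.2.isSome)
      (push (.inl (input, false)) (fun v => sym (v.2.2.getD false)) <|
        push (.inr 1) (fun _ => true) <| goto fun _ => .inl 0)
      (goto fun _ => .inr p.entry)
  | .inl 1 =>
    load (fun v => (v.1, v.2.1, none)) <|
    popAll (branch (fun v => v.2.2.isSome) (goto fun _ => .inl 1) (goto fun _ => .inl 2))
      Finset.univ.toList
  | .inl 2 => push (.inr 0) (fun v => ans v.1) <| load (fun _ => (m₀, none, none)) halt
  | .inr l => code p .inr (.inl 1) l

/-- The configuration in which a program starts: the tape `input` carries the word `x`, translated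
by `sym`, with the head behind its end, and the other tapes are blank. -/
def inputState (input : K) (sym : Bool → Γ) (m₀ : σ) (x : List Bool) : TapeState K Γ σ where
  mem := m₀
  cell := Function.update (fun _ _ => default) input fun i => (x[i]?.map sym).getD default
  head := Function.update (fun _ => 0) input x.length

omit [Inhabited Γ] [Fintype K] in
open Classical in
theorem stepAux_popAll {Λ : Type} (q : Turing.TM2.Stmt (StackAlphabet K Γ) Λ (Register Γ σ))
    (ks : List (Stack K)) (hks : ks.Nodup) (v : Register Γ σ)
    (S : ∀ k, List (StackAlphabet K Γ k)) :
    Turing.TM2.stepAux (popAll q ks) v S =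
      Turing.TM2.stepAux q (v.1, v.2.1, if ∃ k ∈ ks, S k ≠ [] then some true else v.2.2)
        fun k : Stack K => if k ∈ ks then (S k).tail else S k := by
  induction ks generalizing v S with
  | nil => simp [popAll]
  | cons k ks ih =>
    rw [List.nodup_cons] at hks
    simp only [popAll, Turing.TM2.stepAux]
    rw [ih hks.2]
    have h1 : (∃ k' ∈ ks, Function.update S k (S k).tail k' ≠ []) ↔ ∃ k' ∈ ks, S k' ≠ [] := by
      refine exists_congr fun k' => and_congr_right fun hk' => ?_
      have hne : k' ≠ k := fun h => hks.1 (h ▸ hk')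
      rw [Function.update_of_ne hne]
    congr 1
    · simp only [h1, List.mem_cons, exists_eq_or_imp, Prod.mk.injEq, true_and]
      by_cases h2 : ∃ k' ∈ ks, S k' ≠ []
      · simp only [h2, if_true, or_true]
      · simp only [h2, if_false, or_false]
        rcases S k with _ | _ <;> simp
    · funext k'
      by_cases hk : k' = k
      · subst hk; simp [hks.1]
      · simp [hk]

variable {p : TapeProg K Γ σ} {input : K} {sym : Bool → Γ} {m₀ : σ} {ans : σ → Bool}

/-- Clearing the stacks takes as many rounds as the highest of them has elements. -/
theorem steps_clear (n : ℕ) (v : Register Γ σ) (S : ∀ k, List (StackAlphabet K Γ k))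
    (hS : ∀ k, (S k).length ≤ n) :
    ∃ t ≤ n + 1, ∃ v' : Register Γ σ, v'.1 = v.1 ∧ Steps (machineCode p input sym m₀ ans) t
      ⟨some (.inl 1), v, S⟩ ⟨some (.inl 2), v', fun _ => []⟩ := by
  induction n generalizing v S with
  | zero =>
    have h0 : S = fun _ => [] := funext fun k => List.length_eq_zero_iff.1 (Nat.le_zero.1 (hS k))
    have h1 := steps_one (M := machineCode p input sym m₀ ans) (l := .inl 1) rfl v S
    simp only [machineCode, Turing.TM2.stepAux] at h1
    rw [stepAux_popAll _ _ (Finset.nodup_toList _)] at h1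
    simp [h0, Turing.TM2.stepAux] at h1
    refine ⟨1, le_rfl, (v.1, v.2.1, none), rfl, ?_⟩
    rw [h0]
    exact h1
  | succ n ih =>
    have h1 := steps_one (M := machineCode p input sym m₀ ans) (l := .inl 1) rfl v S
    simp only [machineCode, Turing.TM2.stepAux] at h1
    rw [stepAux_popAll _ _ (Finset.nodup_toList _)] at h1
    by_cases h0 : ∃ k, S k ≠ []
    · simp only [Finset.mem_toList, Finset.mem_univ, true_and, h0, if_true,
        Turing.TM2.stepAux, Option.isSome_some, cond_true] at h1
      obtain ⟨t, ht, v', hv', h2⟩ := ih (v.1, v.2.1, some true) (fun k => (S k).tail) fun k => by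
        have := hS k
        rw [List.length_tail]
        omega
      exact ⟨1 + t, by omega, v', hv', h1.trans h2⟩
    · have h2 : S = fun _ => [] := funext fun k => by
        by_contra h
        exact h0 ⟨k, h⟩
      simp [h2, Turing.TM2.stepAux] at h1
      refine ⟨1, by omega, (v.1, v.2.1, none), rfl, ?_⟩
      rw [h2]
      exact h1

/-- Moving the input to its tape. -/
theorem steps_load (x : List Bool) (v : Register Γ σ) (S : ∀ k, List (StackAlphabet K Γ k))
    (hS : S (.inr 0) = x) :
    ∃ (v' : Register Γ σ) (S' : ∀ k, List (StackAlphabet K Γ k)), v'.1 = v.1 ∧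
      Steps (machineCode p input sym m₀ ans) (x.length + 1)
        ⟨some (.inl 0), v, S⟩ ⟨some (.inr p.entry), v', S'⟩ ∧
      S' (.inl (input, false)) = (x.map sym).reverse ++ S (.inl (input, false)) ∧
      (∀ k, k ≠ (input, false) → S' (.inl k) = S (.inl k)) ∧ S' (.inr 0) = [] ∧
      S' (.inr 1) = List.replicate x.length true ++ S (.inr 1) ∧ S' (.inr 2) = S (.inr 2) ∧
      S' (.inr 3) = S (.inr 3) := by
  induction x generalizing v S with
  | nil =>
    have h1 := steps_one (M := machineCode p input sym m₀ ans) (l := .inl 0) rfl v S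
    simp only [machineCode, Turing.TM2.stepAux, hS, List.head?_nil, List.tail_nil,
      Option.isSome_none, cond_false] at h1
    refine ⟨(v.1, v.2.1, none), _, rfl, h1, ?_, fun k _ => ?_, ?_, ?_, ?_, ?_⟩
    · simp
    · simp
    · simp
    · simp
    · simp
    · simp
  | cons b x ih =>
    have h1 := steps_one (M := machineCode p input sym m₀ ans) (l := .inl 0) rfl v S
    simp only [machineCode, Turing.TM2.stepAux, hS, List.head?_cons, List.tail_cons,
      Option.isSome_some, cond_true] at h1
    obtain ⟨S₁, hS₁, h10, h11, h12, h13, h14, h15⟩ : ∃ S₁,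
        Steps (machineCode p input sym m₀ ans) 1
          ⟨some (.inl 0), v, S⟩ ⟨some (.inl 0), (v.1, v.2.1, some b), S₁⟩ ∧
        S₁ (.inl (input, false)) = sym b :: S (.inl (input, false)) ∧
        (∀ k, k ≠ (input, false) → S₁ (.inl k) = S (.inl k)) ∧ S₁ (.inr 0) = x ∧
        S₁ (.inr 1) = true :: S (.inr 1) ∧ S₁ (.inr 2) = S (.inr 2) ∧
        S₁ (.inr 3) = S (.inr 3) := by
      refine ⟨_, h1, ?_, fun k hk => ?_, ?_, ?_, ?_, ?_⟩
      · simp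
      · simp [hk]
      · simp
      · simp
      · simp
      · simp
    obtain ⟨v', S', hv', hS', h20, h21, h22, h23, h24, h25⟩ := ih (v.1, v.2.1, some b) S₁ h12
    refine ⟨v', S', hv', ?_, ?_, fun k hk => ?_, h22, ?_, h24.trans h14, h25.trans h15⟩
    · rw [List.length_cons, add_comm (x.length + 1) 1]
      exact hS₁.trans hS'
    · rw [h20, h10]; simp
    · rw [h21 k hk, h11 k hk]
    · rw [h23, h13, List.length_cons, List.replicate_succ', List.append_assoc]; rfl

/-- **Structured tape programs run in polynomial time.** -/
theorem exists_polyTime [Fintype Γ] [Fintype σ] {α : Type} (enc : α → List Bool) (f : α → Bool)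
    (p : TapeProg K Γ σ) (input : K) (sym : Bool → Γ) (m₀ : σ) (ans : σ → Bool)
    (h : ∀ a, ans (p.run (enc a).length (inputState input sym m₀ (enc a))).mem = f a) :
    Nonempty (Turing.TM2ComputableInPolyTime enc Computability.encodeBool f) := by
  classical
  have : Finite (Label p) := finite_label p
  have : Fintype (Label p) := Fintype.ofFinite _
  let tm : Turing.FinTM2 :=
    { K := Stack K
      k₀ := .inr 0
      k₁ := .inr 0
      Γ := StackAlphabet K Γ
      Λ := Fin 3 ⊕ Label p
      main := .inl 0
      σ := Register Γ σ
      initialState := (m₀, none, none)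
      Γk₀Fin := inferInstanceAs (Fintype Bool)
      m := machineCode p input sym m₀ ans }
  let aux : Turing.TM2ComputableAux Bool Bool := ⟨tm, Equiv.refl Bool, Equiv.refl Bool⟩
  let time : Polynomial ℕ := 4 + 3 * .X + 2 * p.cost
  suffices key : ∀ a, Nonempty (Turing.TM2OutputsInTime aux.tm
      (List.map aux.inputAlphabet.invFun (enc a))
      (some (List.map aux.outputAlphabet.invFun (Computability.encodeBool (f a))))
      (time.eval (enc a).length)) from ⟨⟨aux, time, fun a => (key a).some⟩⟩
  intro a
  set x := enc a with hx
  let S₀ : ∀ k, List (StackAlphabet K Γ k) := Function.update (fun _ => []) (.inr 0) x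
  have hinit : Turing.initList tm (List.map (Equiv.refl Bool).invFun x) =
      ⟨some (.inl 0), (m₀, none, none), S₀⟩ := by
    have hmap : List.map (Equiv.refl Bool).invFun x = x := List.map_id x
    rw [hmap]
    unfold Turing.initList
    congr 1
    funext k
    by_cases hk : k = .inr 0
    · subst hk; simp [S₀, tm]
    · simp [S₀, tm, hk]
  have hhalt : Turing.haltList tm (List.map (Equiv.refl Bool).invFun
      (Computability.encodeBool (f a))) =
      ⟨none, (m₀, none, none), Function.update (fun _ => []) (.inr 0) [f a]⟩ := by
    unfold Turing.haltList
    congr 1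
    funext k
    by_cases hk : k = .inr 0
    · subst hk; simp [tm, Computability.encodeBool]
    · simp [tm, hk]
  have hnil : ∀ k, k ≠ .inr 0 → S₀ k = [] := fun k hk => Function.update_of_ne hk _ _
  obtain ⟨v₁, S₁, hv₁, hs₁, h1, h2, h3, h4, h5, h6⟩ :=
    steps_load (p := p) (input := input) (sym := sym) (m₀ := m₀) (ans := ans) x (m₀, none, none) S₀
      (Function.update_self _ _ _)
  have hR : Represents x.length 0 [] (inputState input sym m₀ x) v₁ S₁ := by
    refine ⟨hv₁, fun k => ?_, fun k i => ?_, h3, ?_, ?_, ?_⟩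
    · by_cases hk : k = input
      · subst hk
        rw [h1, hnil _ (by simp), List.append_nil]
        simp only [inputState, Function.update_self]
        rw [List.map_reverse]
        congr 1
        refine List.ext_getElem (by simp) fun i h1 h2 => ?_
        have hi : i < x.length := by simpa using h1
        simp [hi]
      · rw [h2 _ (by simp [hk]), hnil _ (by simp)]
        simp [inputState, hk]
    · rw [h2 _ (by simp), hnil _ (by simp)]
      by_cases hk : k = input
      · subst hk; simp [inputState]
      · simp [inputState, hk]
    · rw [h4, hnil _ (by simp), List.append_nil]
    · rw [h5, hnil _ (by simp)]; rfl
    · rw [h6, hnil _ (by simp)]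
  obtain ⟨t, ht, v₂, S₂, hs₂, hR₂, hl⟩ := steps_code (M := machineCode p input sym m₀ ans) p
    (emb := .inr) (exit := .inl 1) (fun l => rfl) hR
  have hlen : ∀ k, (S₂ k).length ≤ x.length + t := by
    rintro (⟨k, b⟩ | i)
    · refine (hl (k, b)).trans (Nat.add_le_add_right ?_ _)
      by_cases hk : (k, b) = (input, false)
      · rw [hk, h1, hnil _ (by simp)]; simp
      · rw [h2 _ hk, hnil _ (by simp)]; simp
    · fin_cases i
      · exact (congrArg List.length hR₂.io).trans_le (Nat.zero_le _)
      · exact (congrArg List.length hR₂.ticks).trans_le (by simp)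
      · exact (congrArg List.length hR₂.spent).trans_le (Nat.zero_le _)
      · exact (congrArg List.length hR₂.frames).trans_le (Nat.zero_le _)
  obtain ⟨t', ht', v₃, hv₃, hs₃⟩ := steps_clear (p := p) (input := input) (sym := sym) (m₀ := m₀)
    (ans := ans) _ v₂ S₂ hlen
  have hs₄ := steps_one (M := machineCode p input sym m₀ ans) (l := .inl 2) rfl v₃ fun _ => []
  simp only [machineCode, Turing.TM2.stepAux] at hs₄
  rw [hv₃, hR₂.mem, h a] at hs₄
  have hs := ((hs₁.trans hs₂).trans hs₃).trans hs₄
  refine ⟨⟨⟨x.length + 1 + t + t' + 1, ?_⟩, ?_⟩⟩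
  · change _ = Option.map (Turing.haltList tm) (some _)
    rw [Option.map_some]
    exact hinit ▸ hhalt ▸ hs
  · simp only [time, Polynomial.eval_add, Polynomial.eval_mul, Polynomial.eval_ofNat,
      Polynomial.eval_X]
    omega

end TapeProg
end TapeMachine

/-! ### Evaluating the one-step operator of the simulation game -/

section Algorithm

namespace TapeProg

variable {K Γ σ : Type}

/-- Nested loops: repetition, `L ^ j` times on an input of length `L`. -/
def rep (j : ℕ) (p : TapeProg K Γ σ) : TapeProg K Γ σ := loop^[j] p

variable [DecidableEq K] {L : ℕ}

theorem run_rep (j : ℕ) (p : TapeProg K Γ σ) : run L (rep j p) = (run L p)^[L ^ j] := by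
  induction j with
  | zero => simp [rep]
  | succ j ih =>
    have h : rep (j + 1) p = loop (rep j p) := Function.iterate_succ_apply' _ _ _
    funext s
    rw [h, run, ih, ← Function.iterate_mul, pow_succ]

/-- The invariant rule for counted loops. -/
theorem iterate_induction {α : Type*} {f : α → α} {I : ℕ → α → Prop} {n : ℕ} {s : α} (h₀ : I 0 s)
    (step : ∀ j < n, ∀ s, I j s → I (j + 1) (f s)) : I n (f^[n] s) := by
  have key : ∀ j ≤ n, I j (f^[j] s) := by
    intro j
    induction j with
    | zero => exact fun _ => h₀
    | succ j ih =>
      intro hj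
      rw [Function.iterate_succ_apply']
      exact step j hj _ (ih (by omega))
  exact key n le_rfl

theorem run_loop_induction {p : TapeProg K Γ σ} {I : ℕ → TapeState K Γ σ → Prop}
    {s : TapeState K Γ σ} (h₀ : I 0 s) (step : ∀ j < L, ∀ s, I j s → I (j + 1) (run L p s)) :
    I L (run L (loop p) s) :=
  iterate_induction h₀ step

theorem run_rep_right (j : ℕ) (k : K) (s : TapeState K Γ σ) :
    run L (rep j (right k)) s =
      { s with head := Function.update s.head k (s.head k + L ^ j) } := by
  rw [run_rep]
  exact iterate_induction (s := s) (f := run L (right k))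
    (I := fun i t => t = { s with head := Function.update s.head k (s.head k + i) }) (by simp)
    (by rintro i - _ rfl; simp [run, add_assoc])

theorem run_rep_left (j : ℕ) (k : K) (s : TapeState K Γ σ) :
    run L (rep j (left k)) s =
      { s with head := Function.update s.head k (s.head k - L ^ j) } := by
  rw [run_rep]
  exact iterate_induction (s := s) (f := run L (left k))
    (I := fun i t => t = { s with head := Function.update s.head k (s.head k - i) }) (by simp)
    (by rintro i - _ rfl; simp [run, Nat.sub_sub])

end TapeProg

/-- The tapes of the algorithm: the input, the transition tables of the two automata, the current
values of the set variables, and the result of the last evaluation. In the tables, states and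
letters are digits in base `L`, the length of the input: a transition from `p` to `q` on the letter
`a` is in cell `p * L ^ 2 + a * L + q`. On the tapes `table` and `result`, the cell `p * L + q`
stands for all positions with the states `p` and `q`. -/
inductive Tape
  | input
  | transA
  | transB
  | table
  | result
  deriving DecidableEq

instance : Fintype Tape where
  elems := {.input, .transA, .transB, .table, .result}
  complete k := by cases k <;> decide

/-- The head positions, in the order of the tapes. -/
def heads (i a b t o : ℕ) : Tape → ℕ
  | .input => i
  | .transA => a
  | .transB => b
  | .table => t
  | .result => o

section heads
variable (i a b t o x : ℕ)

@[simp] theorem heads_input : heads i a b t o .input = i := rfl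
@[simp] theorem heads_transA : heads i a b t o .transA = a := rfl
@[simp] theorem heads_transB : heads i a b t o .transB = b := rfl
@[simp] theorem heads_table : heads i a b t o .table = t := rfl
@[simp] theorem heads_result : heads i a b t o .result = o := rfl

@[simp] theorem update_heads_input :
    Function.update (heads i a b t o) .input x = heads x a b t o := by
  funext k; cases k <;> simp

@[simp] theorem update_heads_transA :
    Function.update (heads i a b t o) .transA x = heads i x b t o := by
  funext k; cases k <;> simp

@[simp] theorem update_heads_transB :
    Function.update (heads i a b t o) .transB x = heads i a x t o := by
  funext k; cases k <;> simp

@[simp] theorem update_heads_table :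
    Function.update (heads i a b t o) .table x = heads i a b x o := by
  funext k; cases k <;> simp

@[simp] theorem update_heads_result :
    Function.update (heads i a b t o) .result x = heads i a b t x := by
  funext k; cases k <;> simp

end heads

/-- The number of priorities of the simulation game. -/
abbrev numPrios (n : ℕ) : ℕ := 2 * ((n + 1) * (n + 1))

/-- The tape alphabet. The number of priorities is fixed, so a cell has room for sets of records. A
tape uses only the components that it needs. -/
@[ext] structure Cell (n : ℕ) where
  /-- a letter of the input -/
  bit : Bool
  /-- the priority of a transition, if there is one -/
  trans : Option (Fin (n + 1))
  /-- whether this is the cell of the initial position -/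
  mark : Bool
  /-- the records with which the position belongs to each of the set variables -/
  sets : Fin (numPrios n) → Set (Record n)
  /-- the records with which the position belongs to the result -/
  out : Set (Record n)

instance (n : ℕ) : Inhabited (Cell n) := ⟨⟨false, none, false, fun _ => ∅, ∅⟩⟩

noncomputable instance (n : ℕ) : Fintype (Cell n) := by
  have : Function.Injective fun s : Cell n => (s.bit, s.trans, s.mark, s.sets, s.out) := by
    intro s s' h
    simp only [Prod.mk.injEq] at h
    exact Cell.ext h.1 h.2.1 h.2.2.1 h.2.2.2.1 h.2.2.2.2
  have := Finite.of_injective _ this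
  exact Fintype.ofFinite _

/-- The finite memory of the algorithm. -/
@[ext] structure Memory (n : ℕ) where
  /-- whether the unary number that is being read goes on -/
  digit : Bool
  /-- whether the list that is being read goes on -/
  more : Bool
  /-- the last letter that was read -/
  bit : Bool
  /-- a counter for priorities -/
  count : Fin (n + 1)
  /-- the priority of Adam's move, if it exists -/
  prioA : Option (Fin (n + 1))
  /-- the priority of Eve's move, if it exists -/
  prioB : Option (Fin (n + 1))
  /-- the records with which Eve has a good answer to Adam's move -/
  eve : Set (Record n)
  /-- the records with which Eve has good answers to all of Adam's moves so far -/
  adam : Set (Record n)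
  /-- a copy of a cell -/
  cell : Cell n
  /-- the answer of the algorithm -/
  answer : Bool

instance (n : ℕ) : Inhabited (Memory n) :=
  ⟨⟨false, false, false, 0, none, none, ∅, ∅, default, false⟩⟩

noncomputable instance (n : ℕ) : Fintype (Memory n) := by
  have : Function.Injective fun s : Memory n => (s.digit, s.more, s.bit, s.count, s.prioA, s.prioB,
      s.eve, s.adam, s.cell, s.answer) := by
    intro s s' h
    simp only [Prod.mk.injEq] at h
    obtain ⟨h1, h2, h3, h4, h5, h6, h7, h8, h9, h10⟩ := h
    exact Memory.ext h1 h2 h3 h4 h5 h6 h7 h8 h9 h10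
  have := Finite.of_injective _ this
  exact Fintype.ofFinite _

/-- The programs on these tapes. -/
abbrev Program (n : ℕ) : Type := TapeProg Tape (Cell n) (Memory n)
/-- The configurations of these programs. -/
abbrev State (n : ℕ) : Type := TapeState Tape (Cell n) (Memory n)

open TapeProg Tape

variable {n L : ℕ}

section Evaluation

/-- The records with which a move of priority `e`, as an answer to a move of priority `c`, leads
into the set variable of the priority of this round, if the cell `s` describes the position after
it. -/
def reply (c e : Option (Fin (n + 1))) (s : Cell n) : Set (Record n) :=
  {m | ∃ c', c = some c' ∧ ∃ e', e = some e' ∧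
    m.next c' e' ∈ s.sets ⟨m.prio c' e', Record.prio_lt m c' e'⟩}

/-- Collect the records with which Eve has a good answer, over all targets of her move. -/
noncomputable def targetBLoop : Program n :=
  loop <|
    .seq (read transB fun m s => { m with prioB := s.trans }) <|
    .seq (read table fun m s => { m with eve := m.eve ∪ reply m.prioA m.prioB s }) <|
    .seq (right transB) (right table)

theorem run_targetBLoop (m : Memory n) (C : Tape → ℕ → Cell n) (i a b t o : ℕ) :
    ∃ m' : Memory n, run L targetBLoop ⟨m, C, heads i a b t o⟩ =
        ⟨m', C, heads i a (b + L) (t + L) o⟩ ∧ m'.prioA = m.prioA ∧ m'.adam = m.adam ∧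
      ∀ r, r ∈ m'.eve ↔
        r ∈ m.eve ∨ ∃ q < L, r ∈ reply m.prioA (C transB (b + q)).trans (C table (t + q)) := by
  refine run_loop_induction (I := fun j s => ∃ m' : Memory n,
    s = ⟨m', C, heads i a (b + j) (t + j) o⟩ ∧ m'.prioA = m.prioA ∧ m'.adam = m.adam ∧
      ∀ r, r ∈ m'.eve ↔
        r ∈ m.eve ∨ ∃ q < j, r ∈ reply m.prioA (C transB (b + q)).trans (C table (t + q)))
    ⟨m, rfl, rfl, rfl, by simp⟩ ?_
  rintro j - _ ⟨m', rfl, h1, h2, h3⟩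
  simp only [run, update_heads_transB, update_heads_table, heads_transB, heads_table]
  refine ⟨_, rfl, h1, h2, fun r => ?_⟩
  simp only [Set.mem_union, h3, h1, Nat.exists_lt_succ_right, or_assoc]

/-- Collect the records with which Eve can answer Adam's moves on one letter, over all targets of
his move. -/
noncomputable def targetALoop : Program n :=
  loop <|
    .seq (read transA fun m s => { m with prioA := s.trans, eve := ∅ }) <|
    .seq targetBLoop <|
    .seq (rep 1 (left transB)) <|
    .seq (rep 1 (left table)) <|
    .seq (read transA fun m _ =>
      { m with adam := {r | r ∈ m.adam ∧ (m.prioA ≠ none → r ∈ m.eve)} }) <|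
    .seq (right transA) (rep 1 (right table))

theorem run_targetALoop (m : Memory n) (C : Tape → ℕ → Cell n) (i a b t o : ℕ) :
    ∃ m' : Memory n, run L targetALoop ⟨m, C, heads i a b t o⟩ =
        ⟨m', C, heads i (a + L) b (t + L * L) o⟩ ∧
      ∀ r, r ∈ m'.adam ↔ r ∈ m.adam ∧ ∀ p < L, (C transA (a + p)).trans ≠ none →
        ∃ q < L, r ∈ reply (C transA (a + p)).trans (C transB (b + q)).trans
          (C table (t + p * L + q)) := by
  refine run_loop_induction (I := fun j s => ∃ m' : Memory n,
    s = ⟨m', C, heads i (a + j) b (t + j * L) o⟩ ∧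
      ∀ r, r ∈ m'.adam ↔ r ∈ m.adam ∧ ∀ p < j, (C transA (a + p)).trans ≠ none →
        ∃ q < L, r ∈ reply (C transA (a + p)).trans (C transB (b + q)).trans
          (C table (t + p * L + q)))
    ⟨m, by simp, by simp⟩ ?_
  rintro j - _ ⟨m', rfl, h⟩
  simp only [run, heads_transA]
  obtain ⟨m₁, h1, h2, h3, h4⟩ := run_targetBLoop (L := L)
    { m' with prioA := (C transA (a + j)).trans, eve := ∅ } C i (a + j) b (t + j * L) o
  rw [h1]
  simp only [run_rep_left, run_rep_right, pow_one, heads_transA, heads_transB, heads_table,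
    update_heads_transA, update_heads_transB, update_heads_table, Nat.add_sub_cancel]
  rw [show t + j * L + L = t + (j + 1) * L by ring]
  refine ⟨_, rfl, fun r => ?_⟩
  simp only [Set.mem_ofPred_eq, h3, h, h2, h4, Set.mem_empty_iff_false, false_or,
    Nat.forall_lt_succ_right, and_assoc]

/-- The same over all letters. -/
noncomputable def letterLoop : Program n :=
  loop <| .seq targetALoop <| .seq (rep 2 (left table)) (rep 1 (right transB))

theorem run_letterLoop (m : Memory n) (C : Tape → ℕ → Cell n) (i a b t o : ℕ) :
    ∃ m' : Memory n, run L letterLoop ⟨m, C, heads i a b t o⟩ =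
        ⟨m', C, heads i (a + L * L) (b + L * L) t o⟩ ∧
      ∀ r, r ∈ m'.adam ↔ r ∈ m.adam ∧ ∀ l < L, ∀ p < L, (C transA (a + l * L + p)).trans ≠ none →
        ∃ q < L, r ∈ reply (C transA (a + l * L + p)).trans (C transB (b + l * L + q)).trans
          (C table (t + p * L + q)) := by
  refine run_loop_induction (I := fun j s => ∃ m' : Memory n,
    s = ⟨m', C, heads i (a + j * L) (b + j * L) t o⟩ ∧
      ∀ r, r ∈ m'.adam ↔ r ∈ m.adam ∧ ∀ l < j, ∀ p < L, (C transA (a + l * L + p)).trans ≠ none →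
        ∃ q < L, r ∈ reply (C transA (a + l * L + p)).trans (C transB (b + l * L + q)).trans
          (C table (t + p * L + q)))
    ⟨m, by simp, by simp⟩ ?_
  rintro j - _ ⟨m', rfl, h⟩
  simp only [run]
  obtain ⟨m₁, h1, h2⟩ := run_targetALoop (L := L) m' C i (a + j * L) (b + j * L) t o
  rw [h1]
  simp only [run_rep_left, run_rep_right, pow_one, pow_two, heads_transB, heads_table,
    update_heads_transB, update_heads_table, Nat.add_sub_cancel]
  rw [show a + j * L + L = a + (j + 1) * L by ring, show b + j * L + L = b + (j + 1) * L by ring]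
  refine ⟨_, rfl, fun r => ?_⟩
  simp only [h2, h, Nat.forall_lt_succ_right, and_assoc]

/-- The records that belong to the one-step operator, read off from the tapes, at the states whose
transitions begin at the cells `a` and `b`. -/
def stepRecords (L : ℕ) (C : Tape → ℕ → Cell n) (a b : ℕ) : Set (Record n) :=
  {r | ∀ l < L, ∀ p < L, (C transA (a + l * L + p)).trans ≠ none →
    ∃ q < L, r ∈ reply (C transA (a + l * L + p)).trans (C transB (b + l * L + q)).trans
      (C table (p * L + q))}

/-- Evaluate the one-step operator for one state of the first automaton and all of the second. -/
noncomputable def stateBLoop : Program n :=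
  loop <|
    .seq (read result fun m _ => { m with adam := Set.univ }) <|
    .seq letterLoop <|
    .seq (rep 2 (left transA)) <|
    .seq (write result fun m => { (default : Cell n) with out := m.adam }) (right result)

theorem stepRecords_congr {C C' : Tape → ℕ → Cell n} (h : ∀ k, k ≠ result → C k = C' k) (a b : ℕ) :
    stepRecords L C a b = stepRecords L C' a b := by
  simp only [stepRecords, h transA (by decide), h transB (by decide), h table (by decide)]

theorem run_stateBLoop (m : Memory n) (C : Tape → ℕ → Cell n) (i a b o : ℕ) :
    ∃ (m' : Memory n) (R : ℕ → Cell n), run L stateBLoop ⟨m, C, heads i a b 0 o⟩ =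
        ⟨m', Function.update C result R, heads i a (b + L * (L * L)) 0 (o + L)⟩ ∧
      (∀ x < o, R x = C result x) ∧
      ∀ q < L, (R (o + q)).out = stepRecords L C a (b + q * (L * L)) := by
  refine run_loop_induction (I := fun j s =>
    ∃ (m' : Memory n) (R : ℕ → Cell n),
      s = ⟨m', Function.update C result R, heads i a (b + j * (L * L)) 0 (o + j)⟩ ∧
      (∀ x < o, R x = C result x) ∧
      ∀ q < j, (R (o + q)).out = stepRecords L C a (b + q * (L * L)))
    ⟨m, C result, by simp only [Function.update_eq_self, zero_mul, add_zero], by simp, by simp⟩ ?_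
  rintro j - _ ⟨m', R, rfl, h1, h2⟩
  simp only [run]
  obtain ⟨m₁, h3, h4⟩ := run_letterLoop (L := L) { m' with adam := Set.univ }
    (Function.update C result R) i a (b + j * (L * L)) 0 (o + j)
  rw [h3]
  simp only [run_rep_left, pow_two, heads_transA, heads_result,
    update_heads_transA, update_heads_result, Nat.add_sub_cancel, Function.update_self,
    Function.update_idem]
  rw [show b + j * (L * L) + L * L = b + (j + 1) * (L * L) by ring]
  refine ⟨_, _, rfl, fun x hx => ?_, fun q hq => ?_⟩
  · rw [Function.update_of_ne (by omega), h1 x hx]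
  · rcases Nat.lt_succ_iff_lt_or_eq.1 hq with h | rfl
    · rw [Function.update_of_ne (by omega), h2 q h]
    · rw [Function.update_self]
      ext r
      rw [stepRecords_congr (C' := Function.update C result R)
        fun k hk => (Function.update_of_ne hk _ _).symm]
      simp only [h4, stepRecords, Set.mem_univ, true_and, zero_add, Set.mem_ofPred_eq]

/-- Evaluate the one-step operator for all positions and write it on the tape `result`. -/
noncomputable def stepPass : Program n :=
  .seq
    (loop <| .seq stateBLoop <| .seq (rep 3 (left transB)) (rep 2 (right transA)))
    (.seq (rep 3 (left transA)) (rep 2 (left result)))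

theorem run_stepPass (m : Memory n) (C : Tape → ℕ → Cell n) (i : ℕ) :
    ∃ (m' : Memory n) (R : ℕ → Cell n), run L stepPass ⟨m, C, heads i 0 0 0 0⟩ =
        ⟨m', Function.update C result R, heads i 0 0 0 0⟩ ∧
      ∀ p < L, ∀ q < L, (R (p * L + q)).out = stepRecords L C (p * (L * L)) (q * (L * L)) := by
  have key : ∃ (m' : Memory n) (R : ℕ → Cell n),
      run L (loop <| .seq stateBLoop <| .seq (rep 3 (left transB)) (rep 2 (right transA)))
        ⟨m, C, heads i 0 0 0 0⟩ =
        ⟨m', Function.update C result R, heads i (L * (L * L)) 0 0 (L * L)⟩ ∧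
      ∀ p < L, ∀ q < L, (R (p * L + q)).out = stepRecords L C (p * (L * L)) (q * (L * L)) := by
    refine run_loop_induction (I := fun j s => ∃ (m' : Memory n) (R : ℕ → Cell n),
      s = ⟨m', Function.update C result R, heads i (j * (L * L)) 0 0 (j * L)⟩ ∧
      ∀ p < j, ∀ q < L, (R (p * L + q)).out = stepRecords L C (p * (L * L)) (q * (L * L)))
      ⟨m, C result, by simp only [Function.update_eq_self, zero_mul], by simp⟩ ?_
    rintro j - _ ⟨m', R, rfl, h1⟩
    simp only [run]
    obtain ⟨m₁, R', h2, h3, h4⟩ := run_stateBLoop (L := L) m' (Function.update C result R) i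
      (j * (L * L)) 0 (j * L)
    rw [h2]
    simp only [run_rep_left, run_rep_right, heads_transA, heads_transB, update_heads_transA,
      update_heads_transB, Function.update_idem]
    rw [show j * L + L = (j + 1) * L by ring, show j * (L * L) + L ^ 2 = (j + 1) * (L * L) by ring,
      show 0 + L * (L * L) - L ^ 3 = 0 by rw [show 0 + L * (L * L) = L ^ 3 by ring, Nat.sub_self]]
    refine ⟨_, _, rfl, fun p hp q hq => ?_⟩
    rcases Nat.lt_succ_iff_lt_or_eq.1 hp with h | rfl
    · have hlt : p * L + q < j * L := by
        have : (p + 1) * L ≤ j * L := Nat.mul_le_mul_right _ h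
        rw [add_mul, one_mul] at this
        omega
      rw [h3 _ hlt, Function.update_self, h1 p h q hq]
    · rw [h4 q hq, zero_add]
      exact stepRecords_congr (fun k hk => Function.update_of_ne hk _ _) _ _
  obtain ⟨m', R, h1, h2⟩ := key
  refine ⟨m', R, ?_, h2⟩
  rw [stepPass, run, h1]
  simp only [run, run_rep_left, heads_transA, heads_result, update_heads_transA,
    update_heads_result]
  rw [show L * (L * L) - L ^ 3 = 0 by rw [show L * (L * L) = L ^ 3 by ring, Nat.sub_self],
    show L * L - L ^ 2 = 0 by rw [show L * L = L ^ 2 by ring, Nat.sub_self]]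

end Evaluation

end Algorithm

/-! ### Evaluating the nested fixed point -/

section FixedPointProgram
open TapeProg Tape

variable {n L : ℕ}

/-- Overwrite the `k`-th set variable in each cell of the table, by a set that depends on the cell
of the result. -/
noncomputable def updateSets (k : ℕ) (g : Cell n → Set (Record n)) : Program n :=
  .seq
    (rep 2 <|
      .seq (read table fun m s => { m with cell := s }) <|
      .seq (read result fun m s => { m with adam := g s }) <|
      .seq (write table fun m =>
        { m.cell with sets := fun i => if (i : ℕ) = k then m.adam else m.cell.sets i }) <|
      .seq (right table) (right result))
    (.seq (rep 2 (left table)) (rep 2 (left result)))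

theorem run_updateSets (k : ℕ) (g : Cell n → Set (Record n)) (m : Memory n)
    (C : Tape → ℕ → Cell n) (i : ℕ) :
    ∃ (m' : Memory n) (T : ℕ → Cell n), run L (updateSets k g) ⟨m, C, heads i 0 0 0 0⟩ =
        ⟨m', Function.update C table T, heads i 0 0 0 0⟩ ∧
      ∀ x < L * L, T x = { C table x with
        sets := fun i => if (i : ℕ) = k then g (C result x) else (C table x).sets i } := by
  have key := iterate_induction (n := L ^ 2) (f := run L <|
      .seq (read table fun m s => { m with cell := s }) <|
      .seq (read result fun m s => { m with adam := g s }) <|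
      .seq (write table fun m =>
        { m.cell with sets := fun i => if (i : ℕ) = k then m.adam else m.cell.sets i }) <|
      .seq (right table) (right result)) (s := ⟨m, C, heads i 0 0 0 0⟩)
    (I := fun j s => ∃ (m' : Memory n) (T : ℕ → Cell n),
      s = ⟨m', Function.update C table T, heads i 0 0 j j⟩ ∧
      (∀ x, j ≤ x → T x = C table x) ∧
      ∀ x < j, T x = { C table x with
        sets := fun i => if (i : ℕ) = k then g (C result x) else (C table x).sets i })
    ⟨m, C table, by simp only [Function.update_eq_self], by simp, by simp⟩ (by
      rintro j - _ ⟨m', T, rfl, h1, h2⟩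
      simp only [run, heads_table, heads_result, update_heads_table, update_heads_result,
        Function.update_self, Function.update_idem, ne_eq, reduceCtorEq, not_false_eq_true,
        Function.update_of_ne, h1 j le_rfl]
      refine ⟨_, _, rfl, fun x hx => ?_, fun x hx => ?_⟩
      · rw [Function.update_of_ne (by omega), h1 x (by omega)]
      · rcases Nat.lt_succ_iff_lt_or_eq.1 hx with h | rfl
        · rw [Function.update_of_ne h.ne, h2 x h]
        · rw [Function.update_self])
  obtain ⟨m', T, h1, -, h2⟩ := key
  refine ⟨m', T, ?_, fun x hx => h2 x (by rwa [pow_two])⟩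
  rw [updateSets, run, run_rep, h1]
  simp [run, run_rep_left]

/-- Evaluate the first `k` nested fixed points by iteration. The number of iterations is `L ^ e` for
an input of length `L`. -/
noncomputable def nestProgram (e : ℕ) : ℕ → Program n
  | 0 => stepPass
  | k + 1 =>
    .seq (updateSets k fun _ => if Even k then Set.univ else ∅) <|
      rep e <| .seq (nestProgram e k) (updateSets k Cell.out)

/-- The number of a state of an automaton with a sink: the sink has the number `0`, so that it can
be placed without knowing the number of states. -/
def sinkCode {k : ℕ} : Option (Fin k) → ℕ
  | none => 0
  | some q => q + 1

theorem sinkCode_injective {k : ℕ} : Function.Injective (sinkCode (k := k)) := by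
  rintro (_ | a) (_ | b) h
  · rfl
  · simp [sinkCode] at h
  · simp [sinkCode] at h
  · simp only [sinkCode, Nat.add_right_cancel_iff] at h
    rw [Fin.ext h]

theorem sinkCode_le {k : ℕ} (q : Option (Fin k)) : sinkCode q ≤ k := by
  rcases q with _ | q
  · exact Nat.zero_le _
  · exact q.isLt

variable {d : ℕ}

/-- The positions of the simulation game of two automata. -/
abbrev ContainmentInput.Position (I : ContainmentInput d) : Type :=
  Fin I.statesA × Option (Fin I.statesB) × Record (d + 1)

/-- The cell of a position on the tapes `table` and `result`. -/
def ContainmentInput.cellIndex (I : ContainmentInput d) (L : ℕ) (v : I.Position) : ℕ :=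
  v.1 * L + sinkCode v.2.1

/-- Letters and states, including the sink of the second automaton, are digits in base `L`. -/
structure ContainmentInput.Fits (I : ContainmentInput d) (L : ℕ) : Prop where
  letters : I.letters ≤ L
  statesA : I.statesA ≤ L
  statesB : I.statesB < L

theorem ContainmentInput.Fits.cellIndex_lt {I : ContainmentInput d} (h : I.Fits L)
    (v : I.Position) : I.cellIndex L v < L * L := by
  have h1 : ((v.1 : ℕ) + 1) * L ≤ L * L := Nat.mul_le_mul_right _ (v.1.isLt.trans_le h.statesA)
  have h2 := (sinkCode_le v.2.1).trans_lt h.statesB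
  rw [add_mul, one_mul] at h1
  unfold cellIndex
  omega

/-- The tapes hold the tables of the two automata, and the table marks the initial position. -/
structure ContainmentInput.Tables (I : ContainmentInput d) (L : ℕ)
    (C : Tape → ℕ → Cell (d + 1)) : Prop where
  transA : ∀ (p : Fin I.statesA), ∀ l < L, ∀ p' < L, ∀ c,
    (C transA (p * (L * L) + l * L + p')).trans = some c ↔
      ∃ (hl : l < I.letters) (hp : p' < I.statesA), boundedTrans d I.A p ⟨l, hl⟩ ⟨p', hp⟩ = some c
  transB : ∀ (q : Option (Fin I.statesB)) (l : Fin I.letters), ∀ q' < L, ∀ e,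
    (C transB (sinkCode q * (L * L) + l * L + q')).trans = some e ↔
      ∃ q'', sinkCode q'' = q' ∧ sinkTrans d I.B q l q'' = some e
  mark : ∀ x < L * L,
    (C table x).mark = true ↔ x = I.cellIndex L (I.A.init, some I.B.init, fun _ => 0)

/-- From index `k` on, the set variables in the table have the values `X`. -/
def ContainmentInput.Holds (I : ContainmentInput d) (L : ℕ) (C : Tape → ℕ → Cell (d + 1))
    (X : ℕ → Set I.Position) (k : ℕ) : Prop :=
  ∀ i : Fin (numPrios (d + 1)), k ≤ i → ∀ v : I.Position,
    v.2.2 ∈ (C table (I.cellIndex L v)).sets i ↔ v ∈ X i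

/-- The result tape holds the set `Z`. -/
def ContainmentInput.Result (I : ContainmentInput d) (L : ℕ) (C : Tape → ℕ → Cell (d + 1))
    (Z : Set I.Position) : Prop :=
  ∀ v : I.Position, v.2.2 ∈ (C result (I.cellIndex L v)).out ↔ v ∈ Z

variable {I : ContainmentInput d} {C : Tape → ℕ → Cell (d + 1)} {X : ℕ → Set I.Position}

theorem ContainmentInput.Tables.mem_stepRecords (hL : I.Fits L) (hC : I.Tables L C)
    (hX : I.Holds L C X 0) (v : I.Position) :
    v.2.2 ∈ stepRecords L C (v.1 * (L * L)) (sinkCode v.2.1 * (L * L)) ↔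
      v ∈ simStep (boundedTrans d I.A) (sinkTrans d I.B) X := by
  simp only [stepRecords, simStep, Set.mem_ofPred_eq]
  constructor
  · intro h a p c hc
    have h1 : (C Tape.transA (v.1 * (L * L) + a * L + p)).trans = some c :=
      (hC.transA v.1 a (a.isLt.trans_le hL.letters) p (p.isLt.trans_le hL.statesA) c).2
        ⟨a.isLt, p.isLt, hc⟩
    obtain ⟨q', hq', c', hc', e, he, hr⟩ := h a (a.isLt.trans_le hL.letters) p
      (p.isLt.trans_le hL.statesA) (by simp [h1])
    rw [h1] at hc'
    obtain rfl := Option.some.inj hc'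
    obtain ⟨q, rfl, hq⟩ := (hC.transB v.2.1 a q' hq' e).1 he
    exact ⟨q, e, hq, (hX _ (Nat.zero_le _) (p, q, v.2.2.next c e)).1 hr⟩
  · intro h l hl p hp hne
    obtain ⟨c, hc⟩ := Option.ne_none_iff_exists'.1 hne
    obtain ⟨hl', hp', hc'⟩ := (hC.transA v.1 l hl p hp c).1 hc
    obtain ⟨q, e, he, hY⟩ := h _ _ _ hc'
    have hq : sinkCode q < L := (sinkCode_le q).trans_lt hL.statesB
    exact ⟨sinkCode q, hq, c, hc, e, (hC.transB v.2.1 ⟨l, hl'⟩ _ hq e).2 ⟨q, rfl, he⟩,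
      (hX ⟨_, _⟩ (Nat.zero_le _) (⟨p, hp'⟩, q, v.2.2.next c e)).2 hY⟩

theorem run_updateSets_holds (hL : I.Fits L) {k : ℕ} {g : Cell (d + 1) → Set (Record (d + 1))}
    (hC : I.Tables L C) (hX : I.Holds L C X (k + 1)) {Y : Set I.Position}
    (hY : ∀ v : I.Position, v.2.2 ∈ g (C result (I.cellIndex L v)) ↔ v ∈ Y)
    (m : Memory (d + 1)) (i : ℕ) :
    ∃ m' C', run L (updateSets k g) ⟨m, C, heads i 0 0 0 0⟩ = ⟨m', C', heads i 0 0 0 0⟩ ∧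
      I.Tables L C' ∧ I.Holds L C' (Function.update X k Y) k ∧ C' result = C result := by
  obtain ⟨m', T, h1, h2⟩ := run_updateSets (L := L) k g m C i
  refine ⟨m', _, h1, ⟨?_, ?_, ?_⟩, ?_, ?_⟩
  · simpa using hC.transA
  · simpa using hC.transB
  · intro x hx
    rw [Function.update_self, h2 x hx]
    exact hC.mark x hx
  · intro j hj v
    rw [Function.update_self, h2 _ (hL.cellIndex_lt v)]
    rcases hj.eq_or_lt with h | h
    · simp only [← h, if_true, Function.update_self]
      exact hY v
    · simp only [h.ne', if_false]
      rw [Function.update_of_ne h.ne']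
      exact hX j h v
  · simp

/-- The program leaves the values of the free variables intact, which is what makes it fit for the
induction. -/
theorem run_nestProgram (hL : I.Fits L) (e k : ℕ) {C : Tape → ℕ → Cell (d + 1)}
    {X : ℕ → Set I.Position} (hC : I.Tables L C) (hX : I.Holds L C X k)
    (m : Memory (d + 1)) (i : ℕ) :
    ∃ m' C', run L (nestProgram e k) ⟨m, C, heads i 0 0 0 0⟩ = ⟨m', C', heads i 0 0 0 0⟩ ∧
      I.Tables L C' ∧ I.Holds L C' X k ∧
      I.Result L C' (nest (L ^ e) 0 (simStep (boundedTrans d I.A) (sinkTrans d I.B)) k X) := by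
  induction k generalizing C X m with
  | zero =>
    obtain ⟨m', R, h1, h2⟩ := run_stepPass (L := L) m C i
    refine ⟨m', _, h1, ⟨?_, ?_, ?_⟩, ?_, fun v => ?_⟩
    · simpa using hC.transA
    · simpa using hC.transB
    · simpa using hC.mark
    · intro j hj v
      rw [Function.update_of_ne (by decide)]
      exact hX j hj v
    · rw [Function.update_self, ContainmentInput.cellIndex, h2 _ (v.1.isLt.trans_le hL.statesA) _
        ((sinkCode_le v.2.1).trans_lt hL.statesB)]
      exact hC.mem_stepRecords hL hX v
  | succ k ih =>
    set F := fun Y => nest (L ^ e) 0 (simStep (boundedTrans d I.A) (sinkTrans d I.B)) k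
      (Function.update X k Y) with hF
    set Z : Set I.Position := if Even (k + 0) then Set.univ else ∅ with hZ
    obtain ⟨m₀, C₀, h1, h2, h3, -⟩ := run_updateSets_holds (I := I) hL (Y := Z)
      (g := fun _ => if Even k then Set.univ else ∅) hC hX
      (fun v => by by_cases hk : Even k <;> simp [hZ, hk]) m i
    rw [nestProgram, run, h1, run_rep]
    have drop : ∀ {C' : Tape → ℕ → Cell (d + 1)} {Y : Set I.Position},
        I.Holds L C' (Function.update X k Y) k → I.Holds L C' X (k + 1) := by
      intro C' Y h j hj v
      rw [h j (by omega) v, Function.update_of_ne (by omega)]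
    obtain ⟨m', C', h4, h5, h6, h7⟩ := iterate_induction (n := L ^ e)
      (f := run L (.seq (nestProgram e k) (updateSets k Cell.out)))
      (s := ⟨m₀, C₀, heads i 0 0 0 0⟩)
      (I := fun j s => ∃ m' C', s = ⟨m', C', heads i 0 0 0 0⟩ ∧ I.Tables L C' ∧
        I.Holds L C' (Function.update X k (F^[j] Z)) k ∧ (0 < j → I.Result L C' (F^[j] Z)))
      ⟨m₀, C₀, rfl, h2, h3, by simp⟩ (by
        rintro j - _ ⟨m', C', rfl, h4, h5, -⟩
        obtain ⟨m₁, C₁, h6, h7, h8, h9⟩ := ih h4 h5 m'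
        rw [run, h6]
        obtain ⟨m₂, C₂, h10, h11, h12, h13⟩ := run_updateSets_holds (I := I) hL (g := Cell.out) h7
          (drop h8) h9 m₁ i
        rw [Function.iterate_succ_apply']
        refine ⟨m₂, C₂, h10, h11, h12, fun _ v => ?_⟩
        rw [h13]
        exact h9 v)
    have hpos : 0 < L ^ e := pow_pos (Nat.zero_lt_of_lt hL.statesB) e
    exact ⟨m', C', h4, h5, drop h6, h7 hpos⟩

end FixedPointProgram

/-! ### Reading the transitions -/

section Parser
open TapeProg Tape

variable {n L : ℕ}

/-- The input tape carries the word `w` from the cell `h` on. -/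
def Reads (C : Tape → ℕ → Cell n) (h : ℕ) (w : List Bool) : Prop :=
  ∀ i (hi : i < w.length), (C input (h + i)).bit = w[i]

theorem reads_append {C : Tape → ℕ → Cell n} {h : ℕ} {u w : List Bool} :
    Reads C h (u ++ w) ↔ Reads C h u ∧ Reads C (h + u.length) w := by
  constructor
  · intro hr
    refine ⟨fun i hi => ?_, fun i hi => ?_⟩
    · rw [hr i (by rw [List.length_append]; omega), List.getElem_append_left hi]
    · rw [add_assoc, hr (u.length + i) (by rw [List.length_append]; omega)]
      simp
  · rintro ⟨h1, h2⟩ i hi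
    by_cases hiu : i < u.length
    · rw [h1 i hiu, List.getElem_append_left hiu]
    · obtain ⟨j, rfl⟩ := Nat.exists_eq_add_of_le (not_lt.1 hiu)
      rw [← add_assoc, h2 j (by rw [List.length_append] at hi; omega)]
      simp

theorem reads_cons {C : Tape → ℕ → Cell n} {h : ℕ} {b : Bool} {w : List Bool} :
    Reads C h (b :: w) ↔ (C input h).bit = b ∧ Reads C (h + 1) w := by
  rw [← List.singleton_append, reads_append]
  simp [Reads]

theorem Reads.congr {C C' : Tape → ℕ → Cell n} {h : ℕ} {w : List Bool} (hr : Reads C h w)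
    (hC : C' input = C input) : Reads C' h w := fun i hi => by rw [hC, hr i hi]

/-- The program that does nothing. -/
def skip : Program n := read input fun m _ => m

/-- Read a letter of the input into the memory and move on. -/
def readBit : Program n := .seq (read input fun m s => { m with bit := s.bit }) (right input)

/-- The program `act` moves the head `k` by `x` cells to the right, applies `κ` to the counter and
does not interfere with the reading of numbers and lists. -/
structure Advances (L : ℕ) (act : Program n) (k : Tape) (x : ℕ)
    (κ : Fin (n + 1) → Fin (n + 1)) : Prop where
  cell : ∀ s, (run L act s).cell = s.cell
  head : ∀ s, (run L act s).head = Function.update s.head k (s.head k + x)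
  digit : ∀ s, (run L act s).mem.digit = s.mem.digit
  more : ∀ s, (run L act s).mem.more = s.mem.more
  count : ∀ s, (run L act s).mem.count = κ s.mem.count

theorem advances_skip (k : Tape) : Advances L (skip : Program n) k 0 id := by
  constructor <;> intro s <;> simp [skip, run]

theorem advances_right (k : Tape) : Advances L (right k : Program n) k 1 id := by
  constructor <;> intro s <;> simp [run]

theorem advances_rep_right (j : ℕ) (k : Tape) :
    Advances L (rep j (right k) : Program n) k (L ^ j) id := by
  constructor <;> intro s <;> simp [run_rep_right]

/-- Increase the counter; it wraps around at the end of its range. -/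
def increment : Program n := read input fun m _ => { m with count := m.count + 1 }

theorem advances_increment (k : Tape) : Advances L (increment : Program n) k 0 (· + 1) := by
  constructor <;> intro s <;> simp [increment, run]

/-- Read a letter of a unary number and perform `act` if it is a `1`; idle after its end. -/
def unaryRound (act : Program n) : Program n :=
  .ite Memory.digit
    (.seq readBit <|
      .ite Memory.bit act (read input fun m _ => { m with digit := false }))
    skip

/-- Read a unary number and perform `act` that many times. -/
def unary (act : Program n) : Program n :=
  .seq (read input fun m _ => { m with digit := true }) (loop (unaryRound act))

theorem iterate_unaryRound_of_not_digit {act : Program n} {s : State n}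
    (h : s.mem.digit = false) (r : ℕ) : (run L (unaryRound act))^[r] s = s :=
  Function.iterate_fixed (by simp [unaryRound, run, h, skip]) r

theorem iterate_unaryRound {act : Program n} {k : Tape} {x : ℕ} {κ : Fin (n + 1) → Fin (n + 1)}
    (ha : Advances L act k x κ) (hk : k ≠ input) (j : ℕ) {r : ℕ} (hj : j < r) {s : State n}
    (hs : s.mem.digit = true) (hr : Reads s.cell (s.head input) (numCode j)) :
    let s' := (run L (unaryRound act))^[r] s
    s'.cell = s.cell ∧ s'.head = Function.update (Function.update s.head input
        (s.head input + (j + 1))) k (s.head k + j * x) ∧ s'.mem.more = s.mem.more ∧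
      s'.mem.count = κ^[j] s.mem.count := by
  obtain ⟨r, rfl⟩ : ∃ r', r = r' + 1 := ⟨r - 1, by omega⟩
  induction j generalizing r s with
  | zero =>
    rw [numCode, List.replicate_zero, List.nil_append, reads_cons] at hr
    rw [Function.iterate_succ_apply]
    have h1 : run L (unaryRound act) s = { s with
        mem := { s.mem with bit := false, digit := false }
        head := Function.update s.head input (s.head input + 1) } := by
      simp [unaryRound, run, hs, readBit, hr.1]
    rw [iterate_unaryRound_of_not_digit (by rw [h1]), h1]
    refine ⟨rfl, ?_, rfl, rfl⟩
    funext i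
    by_cases hi : i = k
    · subst hi; simp [hk]
    · simp [hi]
  | succ j ih =>
    rw [numCode, List.replicate_succ, List.cons_append, reads_cons] at hr
    obtain ⟨r, rfl⟩ : ∃ r', r = r' + 1 := ⟨r - 1, by omega⟩
    rw [Function.iterate_succ_apply]
    set s₁ : State n := { s with
        mem := { s.mem with bit := true }
        head := Function.update s.head input (s.head input + 1) } with hs₁
    have h1 : run L (unaryRound act) s = run L act s₁ := by
      simp [unaryRound, run, hs, readBit, hr.1, hs₁]
    have h2 : (run L act s₁).head input = s.head input + 1 := by
      rw [ha.head, Function.update_of_ne hk.symm, hs₁]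
      simp
    have h3 : (run L act s₁).head k = s.head k + x := by
      rw [ha.head, Function.update_self, hs₁]
      simp [hk]
    rw [h1]
    obtain ⟨h4, h5, h6, h7⟩ := ih (s := run L act s₁) (by rw [ha.digit]; exact hs)
      (by rw [h2]; exact hr.2.congr (by rw [ha.cell])) r (by omega)
    refine ⟨h4.trans (ha.cell _), ?_, h6.trans (ha.more _), ?_⟩
    · rw [h5, h2, h3]
      funext i
      by_cases hi : i = k
      · subst hi; simp; ring
      · by_cases hi' : i = input
        · subst hi'; simp [hi]; ring
        · simp [hi, hi', ha.head, hs₁]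
    · rw [h7, ha.count, Function.iterate_succ_apply]

theorem run_unary {act : Program n} {k : Tape} {x : ℕ} {κ : Fin (n + 1) → Fin (n + 1)}
    (ha : Advances L act k x κ) (hk : k ≠ input) {j : ℕ} (hj : j < L) {s : State n}
    (hr : Reads s.cell (s.head input) (numCode j)) :
    let s' := run L (unary act) s
    s'.cell = s.cell ∧ s'.head = Function.update (Function.update s.head input
        (s.head input + (j + 1))) k (s.head k + j * x) ∧ s'.mem.more = s.mem.more ∧
      s'.mem.count = κ^[j] s.mem.count :=
  iterate_unaryRound ha hk j hj (s := { s with mem := { s.mem with digit := true } }) rfl hr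

/-- Read a transition and write it to its cell on the tape `k`: the head moves by `L ^ 2` for the
source, by `L` for the letter and by `1` for the target, while the priority is counted; finally it
returns to the left end. -/
def transition (k : Tape) : Program n :=
  .seq (unary (rep 2 (right k))) <|
  .seq (unary (rep 1 (right k))) <|
  .seq (read input fun m _ => { m with count := 0 }) <|
  .seq (unary increment) <|
  .seq (unary (right k)) <|
  .seq (write k fun m => { (default : Cell n) with trans := some m.count }) <|
  rep 3 (left k)

/-- The index of the cell of a transition (source, letter, priority, target). -/
def transitionIndex (L : ℕ) (t : ℕ × ℕ × ℕ × ℕ) : ℕ := t.1 * (L * L) + t.2.1 * L + t.2.2.2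

/-- The content of the cell of a transition. -/
def transitionCell (n : ℕ) (t : ℕ × ℕ × ℕ × ℕ) : Cell n :=
  { (default : Cell n) with trans := some (Fin.ofNat (n + 1) t.2.2.1) }

theorem iterate_succ_fin (j : ℕ) : (· + 1)^[j] (0 : Fin (n + 1)) = Fin.ofNat (n + 1) j := by
  induction j with
  | zero => rfl
  | succ j ih =>
    rw [Function.iterate_succ_apply', ih]
    ext
    simp [Fin.val_add, Nat.add_mod]

theorem run_transition {k : Tape} (hk : k ≠ input) {t : ℕ × ℕ × ℕ × ℕ} {s : State n}
    (hL : (transitionCode t).length ≤ L) (hx : s.head k + transitionIndex L t ≤ L ^ 3)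
    (hr : Reads s.cell (s.head input) (transitionCode t)) :
    let s' := run L (transition k) s
    s'.cell = Function.update s.cell k (Function.update (s.cell k)
        (s.head k + transitionIndex L t) (transitionCell n t)) ∧
      s'.head = Function.update (Function.update s.head input
        (s.head input + (transitionCode t).length)) k 0 ∧ s'.mem.more = s.mem.more := by
  obtain ⟨p, a, c, q⟩ := t
  have hlen : ∀ j, (numCode j).length = j + 1 := fun j => by simp [numCode]
  simp only [transitionCode, List.length_append, hlen] at hL
  simp only [transitionCode, reads_append, List.length_append, hlen] at hr
  obtain ⟨⟨⟨hr1, hr2⟩, hr3⟩, hr4⟩ := hr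
  simp only [transition, run, run_rep_left]
  obtain ⟨c1, h1, m1, -⟩ := run_unary (s := s) (L := L) (advances_rep_right 2 k) hk (j := p)
    (by omega) hr1
  set s₁ := run L (unary (rep 2 (right k))) s
  obtain ⟨c2, h2, m2, -⟩ := run_unary (s := s₁) (L := L) (advances_rep_right 1 k) hk (j := a)
    (by omega) (by rw [c1, h1]; simpa [hk.symm] using hr2)
  set s₂ := run L (unary (rep 1 (right k))) s₁
  set s₂' : State n := { s₂ with mem := { s₂.mem with count := 0 } } with hs₂'
  obtain ⟨c3, h3, m3, k3⟩ := run_unary (s := s₂') (L := L) (advances_increment k) hk (j := c)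
    (by omega) (by
      change Reads s₂.cell (s₂.head input) _
      rw [c2, c1, h2, h1]; simpa [hk.symm, add_assoc] using hr3)
  set s₃ := run L (unary increment) s₂'
  obtain ⟨c4, h4, m4, k4⟩ := run_unary (s := s₃) (L := L) (advances_right k) hk (j := q)
    (by omega) (by
      rw [c3, h3]
      change Reads s₂.cell (Function.update (Function.update s₂.head _ _) _ _ _) _
      rw [c2, c1, h2, h1]; simpa [hk.symm, add_assoc] using hr4)
  set s₄ := run L (unary (right k)) s₃
  have hc : s₄.cell = s.cell := c4.trans (c3.trans (c2.trans c1))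
  have hcount : s₄.mem.count = Fin.ofNat (n + 1) c := by
    rw [k4, k3, Function.iterate_id]
    exact iterate_succ_fin c
  have hhead : s₄.head = Function.update (Function.update s.head input
      (s.head input + (p + 1 + (a + 1) + (c + 1) + (q + 1)))) k
      (s.head k + transitionIndex L (p, a, c, q)) := by
    rw [h4, h3]
    simp only [hs₂', h2, h1, transitionIndex]
    funext i
    by_cases hi : i = k
    · subst hi; simp; ring
    · by_cases hi' : i = input
      · subst hi'; simp [hi]; ring
      · simp [hi, hi']
  refine ⟨?_, ?_, ?_⟩
  · rw [hc, hcount, hhead, Function.update_self]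
    rfl
  · rw [hhead]
    simp only [transitionCode, List.length_append, hlen, Function.update_self, Function.update_idem]
    rw [Nat.sub_eq_zero_of_le hx]
  · exact m4.trans (m3.trans (m2.trans m1))

/-- Read an entry of a list of transitions; idle after the end of the list. -/
def listRound (k : Tape) (pre : Program n) : Program n :=
  .ite Memory.more
    (.seq readBit <|
      .ite Memory.bit (.seq pre (transition k)) (read input fun m _ => { m with more := false }))
    skip

/-- Read a list of transitions and write them on the tape `k`. The program `pre` moves the head of
that tape to the cell where the table begins. -/
def transitions (k : Tape) (pre : Program n) : Program n :=
  .seq (read input fun m _ => { m with more := true }) (loop (listRound k pre))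

/-- The contents of a tape after the transitions of the list `l` have been written into a table that
begins at cell `x`. -/
def writeTransitions (n L x : ℕ) (l : List (ℕ × ℕ × ℕ × ℕ)) (f : ℕ → Cell n) : ℕ → Cell n :=
  l.foldl (fun f t => Function.update f (x + transitionIndex L t) (transitionCell n t)) f

theorem iterate_listRound {k : Tape} (hk : k ≠ input) {pre : Program n} {x : ℕ}
    (hp : Advances L pre k x id) (l : List (ℕ × ℕ × ℕ × ℕ))
    (hL : ∀ t ∈ l, (transitionCode t).length ≤ L)
    (hx : ∀ t ∈ l, x + transitionIndex L t ≤ L ^ 3) {r : ℕ} (hl : l.length < r) {s : State n}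
    (hs : s.mem.more = true) (hs0 : s.head k = 0)
    (hr : Reads s.cell (s.head input) (listCode transitionCode l)) :
    let s' := (run L (listRound k pre))^[r] s
    s'.cell = Function.update s.cell k (writeTransitions n L x l (s.cell k)) ∧
      s'.head = Function.update s.head input
        (s.head input + (listCode transitionCode l).length) := by
  obtain ⟨r, rfl⟩ : ∃ r', r = r' + 1 := ⟨r - 1, by omega⟩
  induction l generalizing r s with
  | nil =>
    rw [listCode, List.flatMap_nil, List.nil_append, reads_cons] at hr
    rw [Function.iterate_succ_apply]
    have h1 : run L (listRound k pre) s = { s with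
        mem := { s.mem with bit := false, more := false }
        head := Function.update s.head input (s.head input + 1) } := by
      simp [listRound, run, hs, readBit, hr.1]
    have h2 : (run L (listRound k pre))^[r] (run L (listRound k pre) s) =
        run L (listRound k pre) s :=
      Function.iterate_fixed (by rw [h1]; simp [listRound, run, skip]) r
    rw [h2, h1]
    refine ⟨?_, ?_⟩
    · simp [writeTransitions]
    · simp [listCode]
  | cons t l ih =>
    rw [listCode, List.flatMap_cons, List.cons_append, List.cons_append, reads_cons,
      List.append_assoc, reads_append] at hr
    obtain ⟨hr1, hr2, hr3⟩ := hr
    obtain ⟨r, rfl⟩ : ∃ r', r = r' + 1 := ⟨r - 1, by rw [List.length_cons] at hl; omega⟩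
    rw [Function.iterate_succ_apply]
    set s₁ : State n := { s with
        mem := { s.mem with bit := true }
        head := Function.update s.head input (s.head input + 1) } with hs₁
    have h1 : run L (listRound k pre) s = run L (transition k) (run L pre s₁) := by
      simp [listRound, run, hs, readBit, hr1, hs₁]
    rw [h1]
    set s₂ := run L pre s₁ with hs₂
    have h2 : s₂.head = Function.update s₁.head k x := by
      rw [hs₂, hp.head, hs₁]; simp [hk, hs0]
    have h2k : s₂.head k = x := by rw [h2, Function.update_self]
    have h2i : s₂.head input = s.head input + 1 := by
      rw [h2, Function.update_of_ne hk.symm, hs₁]; simp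
    have h2c : s₂.cell = s.cell := hp.cell s₁
    obtain ⟨h3, h4, h5⟩ := run_transition (s := s₂) (L := L) hk (t := t) (hL t (by simp))
      (by rw [h2k]; exact hx t (by simp)) (by rw [h2c, h2i]; exact hr2)
    set s₃ := run L (transition k) s₂
    obtain ⟨h6, h7⟩ := ih (fun t ht => hL t (by simp [ht])) (fun t ht => hx t (by simp [ht]))
      (s := s₃) (h5.trans ((hp.more _).trans hs)) (by rw [h4, Function.update_self])
      (by
        rw [h4, Function.update_of_ne hk.symm, Function.update_self, h2i]
        exact hr3.congr (by rw [h3, Function.update_of_ne hk.symm, h2c]))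
      r (by rw [List.length_cons] at hl; omega)
    refine ⟨?_, ?_⟩
    · rw [h6, h3, h2k, h2c]
      simp [writeTransitions]
    · rw [h7, h4, h2i, h2]
      funext i
      by_cases hi : i = input
      · subst hi
        simp [hk.symm, listCode]
        ring
      · by_cases hi' : i = k
        · subst hi'; simp [hi, hs0]
        · simp [hi, hi', hs₁]

theorem run_transitions {k : Tape} (hk : k ≠ input) {pre : Program n} {x : ℕ}
    (hp : Advances L pre k x id) {l : List (ℕ × ℕ × ℕ × ℕ)}
    (hL : ∀ t ∈ l, (transitionCode t).length ≤ L)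
    (hx : ∀ t ∈ l, x + transitionIndex L t ≤ L ^ 3) (hl : l.length < L) {s : State n}
    (hs0 : s.head k = 0) (hr : Reads s.cell (s.head input) (listCode transitionCode l)) :
    let s' := run L (transitions k pre) s
    s'.cell = Function.update s.cell k (writeTransitions n L x l (s.cell k)) ∧
      s'.head = Function.update s.head input
        (s.head input + (listCode transitionCode l).length) :=
  iterate_listRound hk hp l hL hx hl (s := { s with mem := { s.mem with more := true } }) rfl hs0 hr

end Parser

/-! ### The algorithm -/

section Containment
open TapeProg Tape

theorem length_numCode (j : ℕ) : (numCode j).length = j + 1 := by simp [numCode]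

theorem length_lt_length_listCode {α : Type*} (code : α → List Bool) (l : List α) :
    l.length < (listCode code l).length := by
  induction l with
  | nil => simp [listCode]
  | cons x l ih =>
    simp only [listCode, List.flatMap_cons, List.cons_append, List.length_cons, List.append_assoc,
      List.length_append] at ih ⊢
    omega

theorem length_code_lt_length_listCode {α : Type*} {code : α → List Bool} {l : List α} {x : α}
    (hx : x ∈ l) : (code x).length < (listCode code l).length := by
  induction l with
  | nil => simp at hx
  | cons y l ih =>
    simp only [listCode, List.flatMap_cons, List.cons_append, List.length_cons, List.append_assoc,
      List.length_append] at ih ⊢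
    rcases List.mem_cons.1 hx with rfl | h
    · omega
    · have := ih h
      omega

theorem mem_transitionList {m s : ℕ} {A : ParityAutomaton (Fin m) (Fin s)}
    {t : ℕ × ℕ × ℕ × ℕ} : t ∈ transitionList A ↔
      ∃ (p : Fin m) (a : Fin s) (q : Fin m) (c : ℕ),
        A.trans p a q = some c ∧ t = ((p : ℕ), (a : ℕ), c, (q : ℕ)) := by
  simp only [transitionList, List.mem_flatMap, List.mem_finRange, true_and, List.mem_filterMap,
    Option.map_eq_some_iff, eq_comm (b := t)]

section Index

variable {L : ℕ}

theorem index_lt {p a q : ℕ} (hp : p < L) (ha : a < L) (hq : q < L) :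
    p * (L * L) + a * L + q < L ^ 3 := by
  have h1 : (p + 1) * (L * L) ≤ L * (L * L) := Nat.mul_le_mul_right _ hp
  have h2 : (a + 1) * L ≤ L * L := Nat.mul_le_mul_right _ ha
  have h3 : L ^ 3 = L * (L * L) := by ring
  rw [h3]
  simp only [add_mul, one_mul] at h1 h2
  omega

theorem mul_add_inj {p q p' q' : ℕ} (hq : q < L) (hq' : q' < L)
    (h : p * L + q = p' * L + q') : p = p' ∧ q = q' := by
  have h1 : q = q' := by
    have := congrArg (· % L) h
    simpa [Nat.mul_add_mod', Nat.mod_eq_of_lt hq, Nat.mod_eq_of_lt hq'] using this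
  subst h1
  exact ⟨Nat.eq_of_mul_eq_mul_right (by omega) (Nat.add_right_cancel h), rfl⟩

theorem index_inj {p a q p' a' q' : ℕ} (ha : a < L) (hq : q < L) (ha' : a' < L) (hq' : q' < L)
    (h : p * (L * L) + a * L + q = p' * (L * L) + a' * L + q') : p = p' ∧ a = a' ∧ q = q' := by
  obtain ⟨h1, h2⟩ := mul_add_inj (L := L) (p := p * L + a) (p' := p' * L + a') hq hq'
    (by linarith)
  obtain ⟨h3, h4⟩ := mul_add_inj ha ha' h1
  exact ⟨h3, h4, h2⟩

end Index

section Write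

variable {n L x : ℕ} {l : List (ℕ × ℕ × ℕ × ℕ)}

theorem writeTransitions_of_forall_ne {f : ℕ → Cell n} {y : ℕ}
    (h : ∀ t ∈ l, y ≠ x + transitionIndex L t) : writeTransitions n L x l f y = f y := by
  induction l generalizing f with
  | nil => rfl
  | cons t l ih =>
    rw [writeTransitions, List.foldl_cons]
    exact (ih fun t ht => h t (by simp [ht])).trans (Function.update_of_ne (h t (by simp)) _ _)

theorem writeTransitions_of_mem {t : ℕ × ℕ × ℕ × ℕ} (ht : t ∈ l)
    (h : ∀ t' ∈ l, transitionIndex L t' = transitionIndex L t → t' = t) (f : ℕ → Cell n) :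
    writeTransitions n L x l f (x + transitionIndex L t) = transitionCell n t := by
  induction l generalizing f with
  | nil => simp at ht
  | cons t' l ih =>
    rw [writeTransitions, List.foldl_cons]
    by_cases htl : t ∈ l
    · exact ih htl (fun t' ht' => h t' (by simp [ht'])) _
    · obtain rfl : t = t' := by simpa [htl] using ht
      refine (writeTransitions_of_forall_ne fun t' ht' hy => htl ?_).trans
        (Function.update_self _ _ _)
      rwa [← h t' (by simp [ht']) (by omega)]

/-- The tape holds the table of an automaton after its list of transitions has been written. -/
theorem writeTransitions_transitionList {d m s : ℕ} {A : ParityAutomaton (Fin m) (Fin s)}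
    (hm : m ≤ L) (hs : s ≤ L) {f : ℕ → Cell (d + 1)} (p : Fin m) {a q : ℕ} (ha : a < L)
    (hq : q < L) (hf : (f (x + (p * (L * L) + a * L + q))).trans = none) (c : Fin (d + 1 + 1)) :
    (writeTransitions (d + 1) L x (transitionList A) f
        (x + (p * (L * L) + a * L + q))).trans = some c ↔
      ∃ (ha : a < s) (hq : q < m), boundedTrans d A p ⟨a, ha⟩ ⟨q, hq⟩ = some c := by
  have inj : ∀ t ∈ transitionList A, p * (L * L) + a * L + q = transitionIndex L t →
      ∃ (ha : a < s) (hq : q < m) (e : ℕ), A.trans p ⟨a, ha⟩ ⟨q, hq⟩ = some e ∧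
        t = ((p : ℕ), a, e, q) := by
    intro t ht h
    obtain ⟨p', a', q', e, he, rfl⟩ := mem_transitionList.1 ht
    obtain ⟨h1, rfl, rfl⟩ := index_inj ha hq (a'.isLt.trans_le hs) (q'.isLt.trans_le hm) h
    obtain rfl := Fin.ext h1
    exact ⟨a'.isLt, q'.isLt, e, he, rfl⟩
  by_cases h : ∃ (ha : a < s) (hq : q < m) (e : ℕ), A.trans p ⟨a, ha⟩ ⟨q, hq⟩ = some e
  · obtain ⟨ha, hq, e, he⟩ := h
    have h1 : ((p : ℕ), a, e, q) ∈ transitionList A :=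
      mem_transitionList.2 ⟨p, ⟨a, ha⟩, ⟨q, hq⟩, e, he, rfl⟩
    have h2 := writeTransitions_of_mem (n := d + 1) (L := L) (x := x) h1 (fun t' ht' h' => by
      obtain ⟨_, _, e', he', rfl⟩ := inj t' ht' h'.symm
      rw [he, Option.some.injEq] at he'
      rw [he']) f
    rw [transitionIndex] at h2
    rw [h2]
    simp [transitionCell, boundedTrans, he, ha, hq]
  · rw [writeTransitions_of_forall_ne, hf]
    · simp only [reduceCtorEq, false_iff]
      rintro ⟨ha, hq, h'⟩
      obtain ⟨e, he, -⟩ := Option.map_eq_some_iff.1 h'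
      exact h ⟨ha, hq, e, he⟩
    · intro t ht hy
      obtain ⟨ha, hq, e, he, -⟩ := inj t ht (Nat.add_left_cancel hy)
      exact h ⟨ha, hq, e, he⟩

/-- The table of the automaton with a sink. As the sink is state `0`, the other states move up by
one, and the table of the automaton begins at the cell `L ^ 2 + 1`. -/
theorem writeTransitions_sink {d m s : ℕ} {B : ParityAutomaton (Fin m) (Fin s)}
    (hm : m < L) (hs : s ≤ L) {F : ℕ → Cell (d + 1)}
    (hF : ∀ y < L ^ 2, (F (y * L)).trans = some 1) (hF' : ∀ y, y % L ≠ 0 → (F y).trans = none)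
    (q : Option (Fin m)) (l : Fin s) {q' : ℕ} (hq' : q' < L) (c : Fin (d + 1 + 1)) :
    (writeTransitions (d + 1) L (L ^ 2 + 1) (transitionList B) F
        (sinkCode q * (L * L) + l * L + q')).trans = some c ↔
      ∃ q'', sinkCode q'' = q' ∧ sinkTrans d B q l q'' = some c := by
  have hl := l.isLt.trans_le hs
  have hshift : ∀ u v w, L ^ 2 + 1 + (u * (L * L) + v * L + w) =
      (u + 1) * (L * L) + v * L + (w + 1) := fun u v w => by ring
  -- The shift leaves the cells free that belong to transitions from the sink or into it.
  have hne : sinkCode q = 0 ∨ q' = 0 → ∀ t ∈ transitionList B,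
      sinkCode q * (L * L) + l * L + q' ≠ L ^ 2 + 1 + transitionIndex L t := by
    rintro h t ht heq
    obtain ⟨p, a, r, e, -, rfl⟩ := mem_transitionList.1 ht
    have hr := r.isLt
    change _ = L ^ 2 + 1 + (p * (L * L) + a * L + r) at heq
    rw [hshift] at heq
    obtain ⟨h1, -, h2⟩ := index_inj hl hq' (a.isLt.trans_le hs) (by omega) heq
    omega
  rcases q' with _ | q'
  · rw [writeTransitions_of_forall_ne (hne (.inr rfl)), add_zero, ← mul_assoc, ← add_mul, hF]
    · constructor
      · intro h
        exact ⟨none, rfl, by rcases q with _ | q <;> exact h⟩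
      · rintro ⟨q'', h1, h2⟩
        obtain rfl : q'' = none := sinkCode_injective h1
        rcases q with _ | q <;> exact h2
    · have h1 := Nat.mul_le_mul_right L ((sinkCode_le q).trans_lt hm)
      rw [pow_two]
      simp only [Nat.succ_eq_add_one, add_mul, one_mul] at h1
      omega
  · have hnone : ∀ u v, (F (u * (L * L) + v * L + (q' + 1))).trans = none := fun u v => by
      refine hF' _ ?_
      rw [← mul_assoc, ← add_mul, Nat.mul_add_mod', Nat.mod_eq_of_lt hq']
      omega
    rcases q with _ | p
    · rw [writeTransitions_of_forall_ne (hne (.inl rfl)), hnone]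
      simp only [reduceCtorEq, false_iff]
      rintro ⟨_ | q'', h1, h2⟩
      · simp [sinkCode] at h1
      · simp [sinkTrans] at h2
    · simp only [sinkCode]
      rw [← hshift, writeTransitions_transitionList hm.le hs p hl (by omega)
        (by rw [hshift]; exact hnone _ _)]
      constructor
      · rintro ⟨_, h1, h2⟩
        exact ⟨some ⟨q', h1⟩, rfl, h2⟩
      · rintro ⟨_ | q'', h1, h2⟩
        · simp at h1
        · obtain rfl : (q'' : ℕ) = q' := by simpa using h1
          exact ⟨l.isLt, q''.isLt, h2⟩

end Write

section Parse

variable {n L : ℕ}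

theorem exists_eq_mk {s : State n} {C : Tape → ℕ → Cell n} {h : Tape → ℕ} (hC : s.cell = C)
    (hh : s.head = h) : ∃ m, s = ⟨m, C, h⟩ := by
  subst hC hh
  exact ⟨s.mem, rfl⟩

theorem run_unary_table {act : Program n} {x : ℕ} {κ : Fin (n + 1) → Fin (n + 1)}
    (ha : Advances L act table x κ) {j : ℕ} (hj : j < L) {C : Tape → ℕ → Cell n} (m : Memory n)
    {i : ℕ} (a b t o : ℕ) (hr : Reads C i (numCode j)) :
    ∃ m', run L (unary act) ⟨m, C, heads i a b t o⟩ =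
      ⟨m', C, heads (i + (j + 1)) a b (t + j * x) o⟩ := by
  obtain ⟨h1, h2, -⟩ := run_unary ha (by decide) hj (s := ⟨m, C, heads i a b t o⟩) hr
  exact exists_eq_mk h1 (by rw [h2]; simp)

theorem run_transitions_heads {k : Tape} (hk : k ≠ input) {pre : Program n} {x : ℕ}
    (hp : Advances L pre k x id) {l : List (ℕ × ℕ × ℕ × ℕ)}
    (hL : (listCode transitionCode l).length ≤ L)
    (hx : ∀ t ∈ l, x + transitionIndex L t ≤ L ^ 3) {C : Tape → ℕ → Cell n} (m : Memory n)
    {i a b t o : ℕ} (h0 : heads i a b t o k = 0) (hr : Reads C i (listCode transitionCode l)) :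
    ∃ m', run L (transitions k pre) ⟨m, C, heads i a b t o⟩ =
      ⟨m', Function.update C k (writeTransitions n L x l (C k)),
        heads (i + (listCode transitionCode l).length) a b t o⟩ := by
  obtain ⟨h1, h2⟩ := run_transitions hk hp
    (fun t ht => (length_code_lt_length_listCode ht).le.trans hL) hx
    ((length_lt_length_listCode transitionCode l).trans_le hL)
    (s := ⟨m, C, heads i a b t o⟩) h0 hr
  exact exists_eq_mk h1 (by rw [h2]; simp)

/-- The content of the cell of a transition to the sink. -/
def sinkCell : Cell n := { (default : Cell n) with trans := some 1 }

/-- The content of the cell of the initial position. -/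
def markedCell : Cell n := { (default : Cell n) with mark := true }

/-- The content of the cell of a letter of the input. -/
def bitCell (b : Bool) : Cell n := { (default : Cell n) with bit := b }

/-- Write the transitions to the sink, one for each multiple of `L`. -/
def sinkProgram : Program n :=
  .seq
    (rep 2 <| .seq (write transB fun _ => sinkCell)
      (rep 1 (right transB)))
    (rep 3 (left transB))

theorem run_sinkProgram (hL : 0 < L) (m : Memory n) (C : Tape → ℕ → Cell n) (i a t o : ℕ) :
    ∃ F, run L sinkProgram ⟨m, C, heads i a 0 t o⟩ =
        ⟨m, Function.update C transB F, heads i a 0 t o⟩ ∧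
      (∀ y < L ^ 2, (F (y * L)).trans = some 1) ∧ ∀ y, y % L ≠ 0 → F y = C transB y := by
  have key := iterate_induction (n := L ^ 2) (f := run L <|
      .seq (write transB fun _ => sinkCell)
        (rep 1 (right transB))) (s := ⟨m, C, heads i a 0 t o⟩)
    (I := fun j s => ∃ F, s = ⟨m, Function.update C transB F, heads i a (j * L) t o⟩ ∧
      (∀ y < j, (F (y * L)).trans = some 1) ∧ ∀ y, y % L ≠ 0 → F y = C transB y)
    ⟨C transB, by simp only [Function.update_eq_self, zero_mul], by simp, by simp⟩ (by
      rintro j - _ ⟨F, rfl, h1, h2⟩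
      simp only [run, run_rep_right, heads_transB, update_heads_transB, Function.update_self,
        Function.update_idem, pow_one]
      rw [show j * L + L = (j + 1) * L by ring]
      refine ⟨_, rfl, fun y hy => ?_, fun y hy => ?_⟩
      · rcases Nat.lt_succ_iff_lt_or_eq.1 hy with h | rfl
        · rw [Function.update_of_ne fun h' => h.ne (Nat.eq_of_mul_eq_mul_right hL h'), h1 y h]
        · rw [Function.update_self, sinkCell]
      · rw [Function.update_of_ne (by rintro rfl; simp at hy), h2 y hy])
  obtain ⟨F, h1, h2, h3⟩ := key
  refine ⟨F, ?_, h2, h3⟩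
  rw [sinkProgram, run, run_rep 2, h1]
  simp only [run_rep_left, heads_transB, update_heads_transB]
  rw [show L ^ 2 * L - L ^ 3 = 0 by rw [← pow_succ, Nat.sub_self]]

theorem advances_shift :
    Advances L (.seq (rep 2 (right transB)) (right transB) : Program n) transB (L ^ 2 + 1) id := by
  constructor <;> intro s <;> simp [run, run_rep_right, add_assoc]

/-- Read the input, write the transition tables of the two automata, and mark the cell of the
initial position. -/
def parse : Program n :=
  .seq (rep 1 (left input)) <|
  .seq (unary skip) <|
  .seq (unary skip) <|
  .seq (unary (rep 1 (right table))) <|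
  .seq (transitions transA skip) <|
  .seq (unary skip) <|
  .seq (unary (right table)) <|
  .seq (right table) <|
  .seq sinkProgram <|
  .seq (transitions transB (.seq (rep 2 (right transB)) (right transB))) <|
  .seq (write table fun _ => markedCell) <|
  rep 2 (left table)

variable {d : ℕ} (I : ContainmentInput d)

theorem ContainmentInput.code_eq : I.code = numCode I.letters ++ (numCode I.statesA ++
    (numCode (I.A.init : ℕ) ++ (listCode transitionCode (transitionList I.A) ++
    (numCode I.statesB ++ (numCode (I.B.init : ℕ) ++
      listCode transitionCode (transitionList I.B)))))) := by
  simp only [ContainmentInput.code, automatonCode, List.append_assoc]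

/-- The length of the input bounds all its numbers, as they are in unary. -/
theorem ContainmentInput.fits : I.Fits I.code.length := by
  constructor <;> rw [I.code_eq] <;> simp only [List.length_append, length_numCode] <;> omega

theorem ContainmentInput.two_le_length_code : 2 ≤ I.code.length := by
  rw [I.code_eq]
  simp only [List.length_append, length_numCode]
  omega

theorem inputState_eq (x : List Bool) :
    inputState (input : Tape) bitCell default x =
      (⟨default, Function.update (fun _ _ => default) input
        fun i => (x[i]?.map bitCell).getD default,
        heads x.length 0 0 0 0⟩ : State n) := by
  rw [inputState, ← update_heads_input 0]
  congr 2
  funext k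
  cases k <;> rfl

theorem run_parse :
    ∃ m C i, run I.code.length parse
        (inputState (input : Tape) (bitCell (n := d + 1)) default I.code) =
        ⟨m, C, heads i 0 0 0 0⟩ ∧ I.Tables I.code.length C := by
  set L := I.code.length with hL
  have hfit := I.fits
  rw [← hL] at hfit
  have hlen : I.letters + 1 + (I.statesA + 1 + (I.A.init + 1 +
      ((listCode transitionCode (transitionList I.A)).length + (I.statesB + 1 +
      (I.B.init + 1 + (listCode transitionCode (transitionList I.B)).length))))) = L := by
    rw [hL, I.code_eq]; simp only [List.length_append, length_numCode]
  have hstatesA : I.statesA < L := by omega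
  have hstatesB : I.statesB < L := by omega
  have hletters : I.letters < L := by omega
  rw [inputState_eq, ← hL]
  set C₀ : Tape → ℕ → Cell (d + 1) := Function.update (fun _ _ => default) input
    fun i => (I.code[i]?.map bitCell).getD default with hC₀
  have hr : Reads C₀ 0 I.code := fun i hi => by simp [hC₀, hi, bitCell]
  rw [I.code_eq] at hr
  simp only [reads_append, length_numCode] at hr
  obtain ⟨hr1, hr2, hr3, hr4, hr5, hr6, hr7⟩ := hr
  have h0 : run L (rep 1 (left input)) (⟨default, C₀, heads L 0 0 0 0⟩ : State (d + 1)) =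
      ⟨default, C₀, heads 0 0 0 0 0⟩ := by simp [run_rep_left]
  obtain ⟨m₁, h1⟩ := run_unary_table (advances_skip _) hletters default 0 0 0 0 hr1
  obtain ⟨m₂, h2⟩ := run_unary_table (advances_skip _) hstatesA m₁ 0 0 0 0 hr2
  obtain ⟨m₃, h3⟩ := run_unary_table (L := L) (advances_rep_right 1 _)
    (j := I.A.init) (by omega) m₂ 0 0 0 0 hr3
  obtain ⟨m₄, h4⟩ := run_transitions_heads (L := L) (k := transA) (by decide)
    (advances_skip _) (l := transitionList I.A) (by omega)
    (fun t ht => by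
      obtain ⟨p, a, q, c, -, rfl⟩ := mem_transitionList.1 ht
      rw [zero_add]
      exact (index_lt (p.isLt.trans hstatesA) (a.isLt.trans hletters)
        (q.isLt.trans hstatesA)).le) m₃ (b := 0) (t := I.A.init * L) (o := 0) rfl hr4
  set C₁ := Function.update C₀ transA (writeTransitions (d + 1) L 0 (transitionList I.A)
    (C₀ transA)) with hC₁
  have hC : C₁ input = C₀ input := Function.update_of_ne (by decide) _ _
  obtain ⟨m₅, h5⟩ := run_unary_table (advances_skip _) hstatesB m₄ 0 0 (I.A.init * L) 0
    (hr5.congr hC)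
  obtain ⟨m₆, h6⟩ := run_unary_table (L := L) (advances_right _) (j := I.B.init)
    (by omega) m₅ 0 0 (I.A.init * L) 0
    (hr6.congr hC)
  obtain ⟨F, h7, hF, hF'⟩ := run_sinkProgram (L := L) (by omega) m₆ C₁
    (0 + (I.letters + 1) + (I.statesA + 1) + (I.A.init + 1) +
      (listCode transitionCode (transitionList I.A)).length + (I.statesB + 1) + (I.B.init + 1)) 0
    (I.A.init * L + I.B.init * 1 + 1) 0
  obtain ⟨m₈, h8⟩ := run_transitions_heads (k := transB) (by decide) advances_shift (L := L)
    (l := transitionList I.B) (C := Function.update C₁ transB F) (by omega) (fun t ht => by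
      obtain ⟨p, a, q, c, -, rfl⟩ := mem_transitionList.1 ht
      have h : ((p : ℕ) + 1) * (L * L) + a * L + (q + 1) < L ^ 3 :=
        index_lt (by omega) (by omega) (by omega)
      refine le_trans (le_of_eq ?_) h.le
      simp only [transitionIndex]
      ring) m₆ (a := 0) (t := I.A.init * L + I.B.init * 1 + 1) (o := 0) rfl
    (hr7.congr ((Function.update_of_ne (by decide) _ _).trans hC))
  have h9 : I.A.init * L + I.B.init * 1 + 1 =
      I.cellIndex L (I.A.init, some I.B.init, fun _ => 0) := by
    simp [ContainmentInput.cellIndex, sinkCode, add_assoc]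
  have h10 := hfit.cellIndex_lt (I.A.init, some I.B.init, fun _ => 0)
  rw [mul_zero, add_zero] at h1 h2 h5
  rw [pow_one, zero_add (_ * L)] at h3
  rw [h9] at h7 h8
  rw [Function.update_self, Function.update_idem] at h8
  have hdef : ∀ k, k ≠ input → ∀ y, (C₀ k y) = default := fun k hk y => by
    rw [hC₀, Function.update_of_ne hk]
  have hnone : (default : Cell (d + 1)).trans = none := rfl
  simp only [parse, run, h0, h1, h2, h3, h4, h5, h6, update_heads_table, heads_table, h7, h8, h9,
    run_rep_left]
  rw [Nat.sub_eq_zero_of_le (by rw [pow_two]; exact h10.le)]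
  refine ⟨_, _, _, rfl, ⟨?_, ?_, ?_⟩⟩
  · intro p l hl p' hp' c
    rw [Function.update_of_ne (by decide), Function.update_of_ne (by decide), hC₁,
      Function.update_self, ← zero_add (p * (L * L) + l * L + p')]
    refine writeTransitions_transitionList hfit.statesA hfit.letters p hl hp' ?_ c
    rw [hdef _ (by decide), hnone]
  · intro q l q' hq' c
    rw [Function.update_of_ne (by decide), Function.update_self]
    refine writeTransitions_sink hstatesB hfit.letters hF (fun y hy => ?_) q l hq' c
    rw [hF' y hy, hC₁, Function.update_of_ne (by decide), hdef _ (by decide), hnone]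
  · intro x hx
    rw [Function.update_self]
    by_cases hxi : x = I.cellIndex L (I.A.init, some I.B.init, fun _ => 0)
    · rw [hxi, Function.update_self]
      simp [markedCell]
    · rw [Function.update_of_ne hxi, Function.update_of_ne (by decide), hC₁,
        Function.update_of_ne (by decide), hdef _ (by decide)]
      simp only [hxi, iff_false]
      exact Bool.false_ne_true

end Parse

section Decision

variable {n L : ℕ}

open Classical in
/-- One round of the final scan: if the scanned cell of the table is marked, the answer is whether
the zero record belongs to the set in the scanned cell of the result. -/
noncomputable def acceptRound : Program n :=
  .seq (read table fun m s => { m with cell := s }) <|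
  .seq (read result fun m s =>
    { m with answer := if m.cell.mark then decide ((fun _ => 0) ∈ s.out) else m.answer }) <|
  .seq (right table) (right result)

theorem run_acceptRound {C : Tape → ℕ → Cell n} {x₀ : ℕ} (hx₀ : x₀ < L * L)
    (hC : ∀ x < L * L, (C table x).mark = true ↔ x = x₀) (m : Memory n) (i : ℕ) :
    (run L (rep 2 acceptRound) ⟨m, C, heads i 0 0 0 0⟩).mem.answer = true ↔
      (fun _ => 0) ∈ (C result x₀).out := by
  rw [run_rep, pow_two]
  have key := iterate_induction (n := L * L) (f := run L acceptRound)
    (s := ⟨m, C, heads i 0 0 0 0⟩) (I := fun j s => ∃ m' : Memory n, s = ⟨m', C, heads i 0 0 j j⟩ ∧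
      (x₀ < j → (m'.answer = true ↔ (fun _ => 0) ∈ (C result x₀).out)))
    ⟨m, rfl, by simp⟩ (by
      rintro j hj - ⟨m', rfl, h⟩
      simp only [acceptRound, run, heads_table, heads_result, update_heads_table,
        update_heads_result]
      refine ⟨_, rfl, fun hjx => ?_⟩
      by_cases hjx' : j = x₀
      · subst hjx'
        simp only [(hC j hj).2 rfl, if_true]
        exact @decide_eq_true_iff _ (_)
      · have := mt (hC j hj).1 hjx'
        simp only [this]
        exact h (by omega))
  obtain ⟨m', h1, h2⟩ := key
  rw [h1]
  exact h2 hx₀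

end Decision

/-- For every fixed `d` there is an algorithm (computing `f`) that runs in polynomial time on all
pairs of parity automata with priorities in `[d]` and that, whenever the second automaton is
history-deterministic, answers whether the language of the first is contained in that of the
second. -/
theorem mainTheorem7 (d : ℕ) :
    ∃ f : ContainmentInput d → Bool,
      Nonempty (Turing.TM2ComputableInPolyTime
        (ContainmentInput.code (d := d)) Computability.encodeBool f) ∧
      ∀ I : ContainmentInput d, I.B.HistoryDeterministic →
        (f I = true ↔ I.A.language ⊆ I.B.language) := by
  -- With `R ≤ L ^ R`, the exponent `2 + R` provides as many iterations as there are positions.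
  set R := Fintype.card (Record (d + 1)) with hR
  let program : Program (d + 1) :=
    .seq parse (.seq (nestProgram (2 + R) (numPrios (d + 1))) (rep 2 acceptRound))
  let f : ContainmentInput d → Bool := fun I =>
    (run I.code.length program (inputState input bitCell default I.code)).mem.answer
  have hf : ∀ I, f I = true ↔ (I.A.init, some I.B.init, fun _ => 0) ∈
      simRegion (I.code.length ^ (2 + R)) (boundedTrans d I.A) (sinkTrans d I.B) := by
    intro I
    have hL := I.fits
    obtain ⟨m, C, i, h1, hC⟩ := run_parse I
    obtain ⟨m', C', h2, hC', -, h3⟩ := run_nestProgram (X := fun _ => ∅) hL (2 + R)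
      (numPrios (d + 1)) hC (fun j hj => absurd j.isLt hj.not_gt) m i
    simp only [f, program, run]
    rw [h1, h2, run_acceptRound (hL.cellIndex_lt _) hC'.mark]
    exact h3 _
  have hN : ∀ I : ContainmentInput d, Fintype.card I.Position ≤ I.code.length ^ (2 + R) := by
    intro I
    have hL := I.fits
    have hR' : R ≤ I.code.length ^ R :=
      Nat.lt_two_pow_self.le.trans (Nat.pow_le_pow_left I.two_le_length_code R)
    rw [Fintype.card_prod, Fintype.card_prod, Fintype.card_option, Fintype.card_fin,
      Fintype.card_fin, ← hR, pow_add, pow_two, mul_assoc]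
    exact Nat.mul_le_mul hL.statesA (Nat.mul_le_mul hL.statesB hR')
  refine ⟨f, exists_polyTime _ f program input bitCell default Memory.answer fun I => rfl,
    fun I hI => ?_⟩
  rw [hf]
  exact ⟨language_subset_of_mem_simRegion I.boundA I.boundB (hN I),
    mem_simRegion_of_language_subset I.boundA I.boundB hI (hN I)⟩

end Containment
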